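/- Let $m_L,m_Q,c>0$, let $J_L,J_Q\in\mathbb R^{3\times3}$ be symmetric positive definite, let $k,L,g\in\mathbb R$, $r_1,\dots,r_4\in\mathbb R^3$, $T>0$, and $e_3=(0,0,1)^T$. For $\Omega\in\mathbb R^3$ let $\hat\Omega$ be the skew-symmetric matrix with $\hat\Omega v=\Omega\times v$. Consider four quadrotors of mass $m_Q$ and inertia $J_Q$ carrying a rigid load of mass $m_L$ and inertia $J_L$ by massless elastic cables with rest length $L$, stiffness $k$ and damping constant $c$. The configuration space is $$Q=(SO(3)\times\mathbb R^3)\times(S^2\times\mathbb R)^4\times SO(3)^4\ni(R_L,x_L,(q_j,l_j)_{j=1}^4,(R_j)_{j=1}^4),$$ where $(R_L,x_L)$ are the attitude and position of the load, $q_j,l_j$ the direction and length of cable $j$, and $R_j$ the attitude of quadrotor $j$, whose position is $x_{Q_j}=x_L+R_Lr_j-l_jq_j$. With $\dot R_L=R_L\hat\Omega_L$ and $\dot R_j=R_j\hat\Omega_j$ the Lagrangian is $\mathbf L=K-U$, $$K=\tfrac12m_L\|\dot x_L\|^2+\tfrac12\Omega_L^TJ_L\Omega_L+\sum_{j=1}^4\left(\tfrac12m_Q\|\dot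 x_{Q_j}\|^2+\tfrac12\Omega_j^TJ_Q\Omega_j\right),\qquad U=m_Lg\,e_3^Tx_L+\sum_{j=1}^4\left(m_Qg\,e_3^Tx_{Q_j}+\tfrac12k(L-l_j)^2\right).$$ Let $f_j:[0,T]\to\mathbb R$ and $M_j:[0,T]\to\mathbb R^3$ be continuous controls (thrusts and moments), let $\gamma:[0,T]\to Q$ be a smooth curve with components as above, and put $u_j=f_jR_je_3$. The curve $\gamma$ is called a critical point of the forced action (Lagrange–d'Alembert principle) if for every smooth variation of $\gamma$ in $Q$ with fixed endpoints $$\delta\int_0^T\mathbf L\,dt+\sum_{j=1}^4\int_0^T\left(\delta x_{Q_j}^Tu_j+\langle R_j^T\delta R_j,\hat M_j\rangle-c\,\dot l_j\,\delta l_j\right)dt=0,$$ where $\langle\hat a,\hat b\rangle=a^Tb$. Suppose that $l_j(t)\neq0$ for all $j$ and all $t\in[0,T]$. Then $\gamma$ is a critical point if and only if there are functions $v_L,\Omega_L,\Omega_j:[0,T]\to\mathbb R^3$ such that on $[0,T]$ the controlled Euler–Lagrange equations hold: $$\dot x_L=v_L,\qquad\dot R_L=R_L\hat\Omega_L,$$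 $$m_{\rm eff}(\dot v_L+ge_3)=\sum_{j=1}^4\left(u_j+m_Q\ddot\zeta_j-m_QR_L(\hat\Omega_L^2+\dot{\hat\Omega}_L)r_j\right),$$ $$J_{\rm eff}\dot\Omega_L+\hat\Omega_LJ_{\rm eff}\Omega_L=\sum_{j=1}^4m_Q\hat r_jR_L^T\left(-ge_3-\dot v_L+\ddot\zeta_j+\tfrac1{m_Q}u_j\right),$$ and, for $j=1,\dots,4$, $$m_Qq_j^T\ddot\zeta_j=m_Qq_j^T\left(\dot v_L+R_L(\hat\Omega_L^2+\dot{\hat\Omega}_L)r_j+ge_3-\tfrac1{m_Q}u_j\right)-c\,\dot l_j+k(L-l_j),$$ $$q_j\times\ddot\zeta_j=q_j\times\left(\dot v_L+R_L(\hat\Omega_L^2+\dot{\hat\Omega}_L)r_j+ge_3-\tfrac1{m_Q}u_j\right),$$ $$J_Q\dot\Omega_j=J_Q\Omega_j\times\Omega_j+M_j,\qquad\dot R_j=R_j\hat\Omega_j,$$ where $m_{\rm eff}=4m_Q+m_L$, $J_{\rm eff}=J_L-\sum_{j=1}^4m_Q\hat r_j^2$ and $\zeta_j=l_jq_j$. Solutions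 of these equations are critical points even without the assumption $l_j\neq0$. -/

import Mathlib

open Set MeasureTheory
open scoped ContDiff Matrix

attribute [local instance] Matrix.normedAddCommGroup Matrix.normedSpace

noncomputable section

namespace QuadLoad

/-- Vectors of `ℝ³`. Only the dot product `⬝ᵥ` is used for lengths and angles; the norm of the type
serves only to speak about smoothness, which does not depend on the choice of a norm. -/
abbrev Vec := Fin 3 → ℝ

/-- Real `3 × 3` matrices. -/
abbrev Mat := Matrix (Fin 3) (Fin 3) ℝ

/-- The third vector of the standard basis, opposite to the direction of gravity. -/
def e3 : Vec := ![0, 0, 1]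

/-- The hat map from `ℝ³` to skew-symmetric matrices. -/
def hat (w : Vec) : Mat :=
  !![0, -w 2, w 1;
     w 2, 0, -w 0;
     -w 1, w 0, 0]

/-- The inverse of the hat map (meaningful on skew-symmetric matrices). -/
def vee (A : Mat) : Vec := ![A 2 1, A 0 2, A 1 0]

/-- The inner product on skew-symmetric matrices for which the hat map is an isometry,
that is, `⟨hat a, hat b⟩ = a ⬝ᵥ b`. -/
def skewInner (A B : Mat) : ℝ := (1 / 2) * (Aᵀ * B).trace

/-! ### Configuration space -/

/-- The vector space `(Mat × ℝ³) × (ℝ³ × ℝ)⁴ × Mat⁴` in which the configuration space is embedded.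
Tangent vectors of the configuration space are elements of it as well. -/
abbrev Ambient := (Mat × Vec) × (Fin 4 → Vec × ℝ) × (Fin 4 → Mat)

/-- Attitude `R_L` of the load. -/
def loadAtt (x : Ambient) : Mat := x.1.1

/-- Position `x_L` of the center of mass of the load. -/
def loadPos (x : Ambient) : Vec := x.1.2

/-- Direction `q_j` of the cable `j`. -/
def cableDir (x : Ambient) (j : Fin 4) : Vec := (x.2.1 j).1

/-- Length `l_j` of the cable `j`. -/
def cableLen (x : Ambient) (j : Fin 4) : ℝ := (x.2.1 j).2

/-- Attitude `R_j` of the quadrotor `j`. -/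
def quadAtt (x : Ambient) (j : Fin 4) : Mat := x.2.2 j

/-- The configuration space `Q = (SO(3) × ℝ³) × (S² × ℝ)⁴ × SO(3)⁴`. -/
def Q : Set Ambient :=
  {x | loadAtt x ∈ Matrix.specialOrthogonalGroup (Fin 3) ℝ ∧
    (∀ j, cableDir x j ⬝ᵥ cableDir x j = 1) ∧
    ∀ j, quadAtt x j ∈ Matrix.specialOrthogonalGroup (Fin 3) ℝ}

/-! ### Energies -/

/-- The physical constants of the system. -/
structure Params where
  /-- mass of the load -/
  mL : ℝ
  /-- mass of each quadrotor -/
  mQ : ℝ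
  /-- inertia matrix of the load -/
  JL : Mat
  /-- inertia matrix of each quadrotor -/
  JQ : Mat
  /-- stiffness of the cables -/
  k : ℝ
  /-- damping constant of the cables -/
  c : ℝ
  /-- rest length of the cables -/
  L : ℝ
  /-- gravitational acceleration -/
  g : ℝ
  /-- attachment vectors, in the body frame of the load -/
  r : Fin 4 → Vec
  mL_pos : 0 < mL
  mQ_pos : 0 < mQ
  JL_posDef : JL.PosDef
  JQ_posDef : JQ.PosDef
  c_pos : 0 < c

/-- Position of the quadrotor `j`: `x_{Q_j} = x_L + R_L r_j - l_j q_j`. -/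
def quadPos (P : Params) (x : Ambient) (j : Fin 4) : Vec :=
  loadPos x + loadAtt x *ᵥ P.r j - cableLen x j • cableDir x j

/-- The differential of `quadPos` at `x` applied to the tangent vector `w`. For `w` the velocity of a
curve it is the velocity of the quadrotor, for `w` an infinitesimal variation it is `δx_{Q_j}`. -/
def quadPosDiff (P : Params) (x w : Ambient) (j : Fin 4) : Vec :=
  loadPos w + loadAtt w *ᵥ P.r j - cableLen w j • cableDir x j - cableLen x j • cableDir w j

/-- The body angular velocity `Ω` defined by `R' = R (hat Ω)`. -/
def bodyVel (R R' : Mat) : Vec := vee (Rᵀ * R')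

/-- Kinetic energy at the configuration `x` with velocity `w`. -/
def kinetic (P : Params) (x w : Ambient) : ℝ :=
  (1 / 2) * P.mL * (loadPos w ⬝ᵥ loadPos w)
    + ∑ j, (1 / 2) * P.mQ * (quadPosDiff P x w j ⬝ᵥ quadPosDiff P x w j)
    + (1 / 2) * (bodyVel (loadAtt x) (loadAtt w) ⬝ᵥ P.JL *ᵥ bodyVel (loadAtt x) (loadAtt w))
    + ∑ j, (1 / 2) *
        (bodyVel (quadAtt x j) (quadAtt w j) ⬝ᵥ P.JQ *ᵥ bodyVel (quadAtt x j) (quadAtt w j))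

/-- Potential energy: gravity of the load and of the quadrotors, and elasticity of the cables. -/
def potential (P : Params) (x : Ambient) : ℝ :=
  P.mL * P.g * (e3 ⬝ᵥ loadPos x)
    + ∑ j, (P.mQ * P.g * (e3 ⬝ᵥ quadPos P x j) + (1 / 2) * P.k * (P.L - cableLen x j) ^ 2)

/-- The Lagrangian `K - U`. -/
def lagrangian (P : Params) (x w : Ambient) : ℝ := kinetic P x w - potential P x

/-! ### The Lagrange–d'Alembert principle -/

/-- The time derivative of a function on `[0, T]` (one-sided at the endpoints). -/
def ddt {E : Type*} [NormedAddCommGroup E] [NormedSpace ℝ E] (T : ℝ) (h : ℝ → E) : ℝ → E :=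
  derivWithin h (Icc 0 T)

/-- `γ` is (on `[0, T]`) a smooth curve in `Q` from `a` to `b`. -/
structure IsCurve (T : ℝ) (a b : Ambient) (γ : ℝ → Ambient) : Prop where
  smooth : ContDiffOn ℝ ∞ γ (Icc 0 T)
  mem : ∀ t ∈ Icc 0 T, γ t ∈ Q
  left : γ 0 = a
  right : γ T = b

/-- `Γ` is a smooth variation, with fixed endpoints `a` and `b`, of the curve `γ` in `Q`: it is
defined for parameters `s ∈ (-ε, ε)`, and `Γ s` is the varied curve. -/
structure IsVariation (T : ℝ) (a b : Ambient) (γ : ℝ → Ambient) (ε : ℝ) (Γ : ℝ → ℝ → Ambient) :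
    Prop where
  pos : 0 < ε
  smooth : ContDiffOn ℝ ∞ (fun p : ℝ × ℝ => Γ p.1 p.2) (Ioo (-ε) ε ×ˢ Icc 0 T)
  curve : ∀ s ∈ Ioo (-ε) ε, IsCurve T a b (Γ s)
  zero : ∀ t ∈ Icc 0 T, Γ 0 t = γ t

/-- The integral of the Lagrangian along a curve. -/
def action (P : Params) (T : ℝ) (γ : ℝ → Ambient) : ℝ :=
  ∫ t in (0 : ℝ)..T, lagrangian P (γ t) (ddt T γ t)

/-- The thrust vector `u_j = f_j R_j e₃` in the inertial frame. -/
def thrust (f : Fin 4 → ℝ → ℝ) (γ : ℝ → Ambient) (j : Fin 4) (t : ℝ) : Vec :=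
  f j t • quadAtt (γ t) j *ᵥ e3

/-- The virtual work at time `t`, along the curve `γ` and on the infinitesimal variation `δ`, of the
thrusts, the moments `M_j` and the damping of the cables:
`∑ j, (δx_{Q_j} ⬝ u_j + ⟨R_jᵀ δR_j, hat M_j⟩ - c l_j' δl_j)`. -/
def virtualWork (P : Params) (T : ℝ) (f : Fin 4 → ℝ → ℝ) (M : Fin 4 → ℝ → Vec)
    (γ δ : ℝ → Ambient) (t : ℝ) : ℝ :=
  ∑ j, (quadPosDiff P (γ t) (δ t) j ⬝ᵥ thrust f γ j t
    + skewInner ((quadAtt (γ t) j)ᵀ * quadAtt (δ t) j) (hat (M j t))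
    - P.c * cableLen (ddt T γ t) j * cableLen (δ t) j)

/-- `γ` is a critical point of the forced action (Lagrange–d'Alembert): for every variation with
fixed endpoints the derivative of the action plus the integral of the virtual work vanishes. -/
def IsCritical (P : Params) (T : ℝ) (f : Fin 4 → ℝ → ℝ) (M : Fin 4 → ℝ → Vec) (a b : Ambient)
    (γ : ℝ → Ambient) : Prop :=
  ∀ (ε : ℝ) (Γ : ℝ → ℝ → Ambient), IsVariation T a b γ ε Γ →
    ∃ dA : ℝ, HasDerivAt (fun s => action P T (Γ s)) dA 0 ∧
      dA + ∫ t in (0 : ℝ)..T, virtualWork P T f M γ (fun τ => deriv (fun s => Γ s τ) 0) t = 0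

/-! ### The controlled Euler–Lagrange equations -/

/-- Effective mass. -/
def mEff (P : Params) : ℝ := 4 * P.mQ + P.mL

/-- Effective inertia matrix. -/
def JEff (P : Params) : Mat := P.JL - ∑ j, P.mQ • (hat (P.r j) * hat (P.r j))

/-- The vector `ζ_j = l_j q_j`. -/
def zeta (γ : ℝ → Ambient) (j : Fin 4) (t : ℝ) : Vec := cableLen (γ t) j • cableDir (γ t) j

/-- The acceleration `R_L (Ω̂_L² + Ω̂_L') r_j` of the attachment point `j` relative to the center of
mass of the load. -/
def attachAcc (P : Params) (T : ℝ) (γ : ℝ → Ambient) (ΩL : ℝ → Vec) (j : Fin 4) (t : ℝ) : Vec :=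
  (loadAtt (γ t) * (hat (ΩL t) * hat (ΩL t) + hat (ddt T ΩL t))) *ᵥ P.r j

/-- The controlled Euler–Lagrange equations on `[0, T]` for the curve `γ`, the velocity `vL` of the
load, and the body angular velocities `ΩL` of the load and `Ω j` of the quadrotors. -/
structure EulerLagrange (P : Params) (T : ℝ) (f : Fin 4 → ℝ → ℝ) (M : Fin 4 → ℝ → Vec)
    (γ : ℝ → Ambient) (vL ΩL : ℝ → Vec) (Ω : Fin 4 → ℝ → Vec) : Prop where
  load_pos_kin : ∀ t ∈ Icc 0 T, ddt T (fun τ => loadPos (γ τ)) t = vL t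
  load_att_kin : ∀ t ∈ Icc 0 T,
    ddt T (fun τ => loadAtt (γ τ)) t = loadAtt (γ t) * hat (ΩL t)
  load_pos_dyn : ∀ t ∈ Icc 0 T,
    mEff P • (ddt T vL t + P.g • e3) =
      ∑ j, (thrust f γ j t + P.mQ • ddt T (ddt T (zeta γ j)) t
        - P.mQ • attachAcc P T γ ΩL j t)
  load_att_dyn : ∀ t ∈ Icc 0 T,
    JEff P *ᵥ ddt T ΩL t + hat (ΩL t) *ᵥ (JEff P *ᵥ ΩL t) =
      ∑ j, P.mQ • hat (P.r j) *ᵥ ((loadAtt (γ t))ᵀ *ᵥ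
        (-(P.g • e3) - ddt T vL t + ddt T (ddt T (zeta γ j)) t + (1 / P.mQ) • thrust f γ j t))
  cable_len_dyn : ∀ j, ∀ t ∈ Icc 0 T,
    P.mQ * (cableDir (γ t) j ⬝ᵥ ddt T (ddt T (zeta γ j)) t) =
      P.mQ * (cableDir (γ t) j ⬝ᵥ
        (ddt T vL t + attachAcc P T γ ΩL j t + P.g • e3 - (1 / P.mQ) • thrust f γ j t))
      - P.c * ddt T (fun τ => cableLen (γ τ) j) t + P.k * (P.L - cableLen (γ t) j)
  cable_dir_dyn : ∀ j, ∀ t ∈ Icc 0 T,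
    cableDir (γ t) j ⨯₃ ddt T (ddt T (zeta γ j)) t =
      cableDir (γ t) j ⨯₃
        (ddt T vL t + attachAcc P T γ ΩL j t + P.g • e3 - (1 / P.mQ) • thrust f γ j t)
  quad_att_dyn : ∀ j, ∀ t ∈ Icc 0 T,
    P.JQ *ᵥ ddt T (Ω j) t = (P.JQ *ᵥ Ω j t) ⨯₃ Ω j t + M j t
  quad_att_kin : ∀ j, ∀ t ∈ Icc 0 T,
    ddt T (fun τ => quadAtt (γ τ) j) t = quadAtt (γ t) j * hat (Ω j t)

end QuadLoad

end

open Set MeasureTheory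
open scoped ContDiff Matrix

attribute [local instance] Matrix.normedAddCommGroup Matrix.normedSpace

noncomputable section

namespace QuadLoad

/-! ### Algebra of the hat map -/

/-! Let `δ` be the infinitesimal variation. Differentiating under the integral and exchanging the
two derivatives turns the varied action into the integral of `lagrangianDiff` on `(δ, δ')`. The
`momentum`, which pairs the velocity gradient of the Lagrangian with `δ`, has time derivative
`lagrangianDiff + virtualWork - balance`, where `balance` is linear in `δ t` and contains no `δ'`
(`hasDerivWithinAt_momentum`). Only the rotations go beyond Euclidean integration by parts: if `R' =
R Ω̂` and `δR = R η̂`, then `δΩ = η' + Ω × η` (`bodyVel_sub_bodyVel`), and this produces the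
gyroscopic terms `JΩ × Ω`. Since `δ` vanishes at both ends, criticality means that the integral of
`balance` is zero for every variation (`isCritical_iff_integral_balance`).

The rest is pointwise linear algebra. By `balance_eq`, `balance` pairs force and moment residuals
with the independent displacements and rotations, and its last terms are `-l_j F_j ⬝ δq_j`, with
`F_j` the net force on quadrotor `j`. As `δq_j` is orthogonal to `q_j`, these vanish once `F_j` is
parallel to `q_j`, whatever `l_j` is. Conversely, Cayley rotations scaled by a function of time
realize every tangent direction, so the fundamental lemma makes `balance` vanish pointwise.
Evaluating it on the residuals themselves gives a sum of squares, in which `q_j × F_j` carries the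
factor `l_j²`; this is why the converse assumes `l_j ≠ 0`.

Finally the vanishing residuals are rewritten as the stated equations: the quadrotor acceleration is
`v_L' + R_L(Ω̂_L² + Ω̂_L')r_j - ζ_j''`, and the inertia of the attached masses is absorbed into
`mEff` and `JEff` (`eulerLagrange_iff_balanced`). -/

theorem hat_vee {S : Mat} (hS : Sᵀ = -S) : hat (vee S) = S := by
  have h := fun i k => congrFun (congrFun hS i) k
  have h00 := h 0 0
  have h11 := h 1 1
  have h22 := h 2 2
  have h01 := h 0 1
  have h02 := h 0 2
  have h12 := h 1 2
  simp only [Matrix.transpose_apply, Matrix.neg_apply] at h00 h11 h22 h01 h02 h12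
  ext i k
  fin_cases i <;> fin_cases k <;> simp [hat, vee] <;> linarith

theorem vee_hat (w : Vec) : vee (hat w) = w := by
  ext i
  fin_cases i <;> simp [hat, vee]

theorem hat_transpose (w : Vec) : (hat w)ᵀ = -hat w := by
  ext i k
  fin_cases i <;> fin_cases k <;> simp [hat]

theorem hat_mulVec (w v : Vec) : hat w *ᵥ v = w ⨯₃ v := by
  ext i
  fin_cases i <;> simp [hat, cross_apply, Matrix.mulVec, dotProduct, Fin.sum_univ_three] <;> ring

theorem vee_sub (A B : Mat) : vee (A - B) = vee A - vee B := by
  ext i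
  fin_cases i <;> simp [vee]

theorem vee_commutator (v w : Vec) : vee (hat v * hat w - hat w * hat v) = v ⨯₃ w := by
  ext i
  fin_cases i <;> simp [vee, hat, cross_apply] <;> ring

theorem transpose_mul_self_of_mem {R : Mat} (hR : R ∈ Matrix.specialOrthogonalGroup (Fin 3) ℝ) :
    Rᵀ * R = 1 :=
  (Matrix.mem_orthogonalGroup_iff' (Fin 3) ℝ).1 (Matrix.mem_specialOrthogonalGroup_iff.1 hR).1

/-- Tangent vectors of the orthogonal group at `R`. -/
def IsOrthTangent (R X : Mat) : Prop := (Rᵀ * X)ᵀ = -(Rᵀ * X)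

/-- Turns the virtual work of the moments into an ordinary dot product with the infinitesimal body
rotation. -/
theorem skewInner_transpose_mul_hat {R X : Mat} (hX : IsOrthTangent R X) (m : Vec) :
    skewInner (Rᵀ * X) (hat m) = bodyVel R X ⬝ᵥ m := by
  have key : ∀ w : Vec, skewInner (hat w) (hat m) = w ⬝ᵥ m := fun w => by
    simp [skewInner, Matrix.trace, Matrix.mul_apply, hat, dotProduct, Fin.sum_univ_three]
    ring
  rw [← key, bodyVel, hat_vee hX]

theorem IsOrthTangent.mul_hat {R X : Mat} (hX : IsOrthTangent R X) (hR : Rᵀ * R = 1) :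
    R * hat (bodyVel R X) = X := by
  rw [bodyVel, hat_vee hX, ← Matrix.mul_assoc, mul_eq_one_comm.1 hR, Matrix.one_mul]

theorem bodyVel_mul_hat {R : Mat} (hR : Rᵀ * R = 1) (w : Vec) : bodyVel R (R * hat w) = w := by
  rw [bodyVel, ← Matrix.mul_assoc, hR, Matrix.one_mul, vee_hat]

theorem isOrthTangent_mul_hat {R : Mat} (hR : Rᵀ * R = 1) (w : Vec) :
    IsOrthTangent R (R * hat w) := by
  rw [IsOrthTangent, ← Matrix.mul_assoc, hR, Matrix.one_mul, hat_transpose]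

/-- The variation of the angular velocity exceeds the derivative of the infinitesimal rotation
by the cross product of the two. -/
theorem bodyVel_sub_bodyVel {R X Y : Mat} (hX : IsOrthTangent R X) (hY : IsOrthTangent R Y)
    (hR : Rᵀ * R = 1) :
    bodyVel Y X - bodyVel X Y = bodyVel R X ⨯₃ bodyVel R Y := by
  -- `RᵀR = 1` removes `R` from both products, so their difference is a commutator of hat matrices,
  -- that is, the hat of a cross product.
  have key : ∀ v w : Vec, (R * hat v)ᵀ * (R * hat w) = -(hat v * hat w) := fun v w => by
    rw [Matrix.transpose_mul, Matrix.mul_assoc, ← Matrix.mul_assoc Rᵀ, hR, Matrix.one_mul,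
      hat_transpose, Matrix.neg_mul]
  have h : ∀ v w : Vec, bodyVel (R * hat w) (R * hat v) - bodyVel (R * hat v) (R * hat w) = v ⨯₃ w :=
    fun v w => by
      rw [bodyVel, bodyVel, key, key, ← vee_sub, ← vee_commutator]
      congr 1
      abel
  simpa only [hX.mul_hat hR, hY.mul_hat hR] using h (bodyVel R X) (bodyVel R Y)

/-! ### Derivatives of products -/

section Deriv

variable {s : Set ℝ} {t : ℝ}

theorem hasDerivWithinAt_mat {A : ℝ → Mat} {A' : Mat} :
    HasDerivWithinAt A A' s t ↔ ∀ i k, HasDerivWithinAt (fun τ => A τ i k) (A' i k) s t :=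
  hasDerivWithinAt_pi.trans (forall_congr' fun _ => hasDerivWithinAt_pi)

theorem _root_.HasDerivWithinAt.dot {u v : ℝ → Vec} {u' v' : Vec}
    (hu : HasDerivWithinAt u u' s t) (hv : HasDerivWithinAt v v' s t) :
    HasDerivWithinAt (fun τ => u τ ⬝ᵥ v τ) (u' ⬝ᵥ v t + u t ⬝ᵥ v') s t := by
  rw [hasDerivWithinAt_pi] at hu hv
  simp only [dotProduct, ← Finset.sum_add_distrib]
  exact HasDerivWithinAt.fun_sum fun i _ => (hu i).mul (hv i)

theorem _root_.HasDerivWithinAt.mat_mul {A B : ℝ → Mat} {A' B' : Mat}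
    (hA : HasDerivWithinAt A A' s t) (hB : HasDerivWithinAt B B' s t) :
    HasDerivWithinAt (fun τ => A τ * B τ) (A' * B t + A t * B') s t := by
  rw [hasDerivWithinAt_mat] at hA hB ⊢
  intro i k
  simp only [Matrix.mul_apply, Matrix.add_apply, ← Finset.sum_add_distrib]
  exact HasDerivWithinAt.fun_sum fun n _ => (hA i n).mul (hB n k)

theorem _root_.HasDerivWithinAt.mat_transpose {A : ℝ → Mat} {A' : Mat}
    (hA : HasDerivWithinAt A A' s t) : HasDerivWithinAt (fun τ => (A τ)ᵀ) A'ᵀ s t := by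
  rw [hasDerivWithinAt_mat] at hA ⊢
  exact fun i k => hA k i

theorem _root_.HasDerivWithinAt.mulVec_const {A : ℝ → Mat} {A' : Mat}
    (hA : HasDerivWithinAt A A' s t) (v : Vec) :
    HasDerivWithinAt (fun τ => A τ *ᵥ v) (A' *ᵥ v) s t := by
  rw [hasDerivWithinAt_mat] at hA
  rw [hasDerivWithinAt_pi]
  simp only [Matrix.mulVec, dotProduct]
  exact fun i => HasDerivWithinAt.fun_sum fun n _ => (hA i n).mul_const (v n)

theorem _root_.HasDerivWithinAt.const_mulVec {v : ℝ → Vec} {v' : Vec} (A : Mat)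
    (hv : HasDerivWithinAt v v' s t) : HasDerivWithinAt (fun τ => A *ᵥ v τ) (A *ᵥ v') s t := by
  rw [hasDerivWithinAt_pi] at hv ⊢
  simp only [Matrix.mulVec, dotProduct]
  exact fun i => HasDerivWithinAt.fun_sum fun n _ => (hv n).const_mul (A i n)

theorem _root_.HasDerivWithinAt.hat {v : ℝ → Vec} {v' : Vec} (hv : HasDerivWithinAt v v' s t) :
    HasDerivWithinAt (fun τ => hat (v τ)) (hat v') s t := by
  rw [hasDerivWithinAt_pi] at hv
  rw [hasDerivWithinAt_mat]
  intro i k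
  fin_cases i <;> fin_cases k
  exacts [hasDerivWithinAt_const .., (hv 2).neg, hv 1, hv 2, hasDerivWithinAt_const ..,
    (hv 0).neg, (hv 1).neg, hv 0, hasDerivWithinAt_const ..]

theorem _root_.HasDerivWithinAt.vee {A : ℝ → Mat} {A' : Mat} (hA : HasDerivWithinAt A A' s t) :
    HasDerivWithinAt (fun τ => vee (A τ)) (vee A') s t := by
  rw [hasDerivWithinAt_mat] at hA
  rw [hasDerivWithinAt_pi]
  intro i
  fin_cases i
  exacts [hA 2 1, hA 0 2, hA 1 0]

theorem vee_add (A B : Mat) : vee (A + B) = vee A + vee B := by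
  ext i
  fin_cases i <;> simp [vee]

theorem _root_.HasDerivWithinAt.bodyVel {A B : ℝ → Mat} {A' B' : Mat}
    (hA : HasDerivWithinAt A A' s t) (hB : HasDerivWithinAt B B' s t) :
    HasDerivWithinAt (fun τ => bodyVel (A τ) (B τ)) (bodyVel A' (B t) + bodyVel (A t) B') s t := by
  have h := (hA.mat_transpose.mat_mul hB).vee
  rwa [vee_add] at h

/-- Differentiate `RᵀR = 1`. This serves both for velocities (the parameter is time) and for
infinitesimal variations (the parameter is `s`). -/
theorem isOrthTangent_of_hasDerivWithinAt {R : ℝ → Mat} {R' : Mat}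
    (hR : HasDerivWithinAt R R' s t) (hs : UniqueDiffWithinAt ℝ s t) (ht : t ∈ s)
    (h : ∀ τ ∈ s, (R τ)ᵀ * R τ = 1) : IsOrthTangent (R t) R' := by
  have h1 := hR.mat_transpose.mat_mul hR
  have h2 : HasDerivWithinAt (fun τ => (R τ)ᵀ * R τ) (0 : Mat) s t :=
    (hasDerivWithinAt_const t s (1 : Mat)).congr h (h t ht)
  have h3 := hs.eq_deriv _ h1 h2
  rw [IsOrthTangent, Matrix.transpose_mul, Matrix.transpose_transpose]
  exact eq_neg_of_add_eq_zero_left h3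

theorem hasDerivWithinAt_fst {E F : Type*} [NormedAddCommGroup E] [NormedSpace ℝ E]
    [NormedAddCommGroup F] [NormedSpace ℝ F] {u : ℝ → E × F} {u' : E × F}
    (hu : HasDerivWithinAt u u' s t) : HasDerivWithinAt (fun τ => (u τ).1) u'.1 s t :=
  (ContinuousLinearMap.fst ℝ E F).hasFDerivAt.comp_hasDerivWithinAt t hu

theorem hasDerivWithinAt_snd {E F : Type*} [NormedAddCommGroup E] [NormedSpace ℝ E]
    [NormedAddCommGroup F] [NormedSpace ℝ F] {u : ℝ → E × F} {u' : E × F}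
    (hu : HasDerivWithinAt u u' s t) : HasDerivWithinAt (fun τ => (u τ).2) u'.2 s t :=
  (ContinuousLinearMap.snd ℝ E F).hasFDerivAt.comp_hasDerivWithinAt t hu

/-! ### Differentials of the quadrotor positions and of the Lagrangian -/

section Ambient

variable {x w : ℝ → Ambient} {x' w' : Ambient}

theorem _root_.HasDerivWithinAt.loadAtt (hx : HasDerivWithinAt x x' s t) :
    HasDerivWithinAt (fun τ => loadAtt (x τ)) (loadAtt x') s t :=
  hasDerivWithinAt_fst (hasDerivWithinAt_fst hx)

theorem _root_.HasDerivWithinAt.loadPos (hx : HasDerivWithinAt x x' s t) :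
    HasDerivWithinAt (fun τ => loadPos (x τ)) (loadPos x') s t :=
  hasDerivWithinAt_snd (hasDerivWithinAt_fst hx)

theorem _root_.HasDerivWithinAt.cableDir (hx : HasDerivWithinAt x x' s t) (j : Fin 4) :
    HasDerivWithinAt (fun τ => cableDir (x τ) j) (cableDir x' j) s t :=
  hasDerivWithinAt_fst (hasDerivWithinAt_pi.1 (hasDerivWithinAt_fst (hasDerivWithinAt_snd hx)) j)

theorem _root_.HasDerivWithinAt.cableLen (hx : HasDerivWithinAt x x' s t) (j : Fin 4) :
    HasDerivWithinAt (fun τ => cableLen (x τ) j) (cableLen x' j) s t :=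
  hasDerivWithinAt_snd (hasDerivWithinAt_pi.1 (hasDerivWithinAt_fst (hasDerivWithinAt_snd hx)) j)

theorem _root_.HasDerivWithinAt.quadAtt (hx : HasDerivWithinAt x x' s t) (j : Fin 4) :
    HasDerivWithinAt (fun τ => quadAtt (x τ) j) (quadAtt x' j) s t :=
  hasDerivWithinAt_pi.1 (hasDerivWithinAt_snd (hasDerivWithinAt_snd hx)) j

theorem _root_.HasDerivWithinAt.quadPos (P : Params) (hx : HasDerivWithinAt x x' s t) (j : Fin 4) :
    HasDerivWithinAt (fun τ => quadPos P (x τ) j) (quadPosDiff P (x t) x' j) s t := by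
  refine ((hx.loadPos.add (hx.loadAtt.mulVec_const (P.r j))).sub
    ((hx.cableLen j).smul (hx.cableDir j))).congr_deriv ?_
  simp only [quadPosDiff]
  abel

/-- The mixed part of the second differential of the position of the quadrotor `j`. -/
def quadPosMixed (w v : Ambient) (j : Fin 4) : Vec :=
  -(cableLen v j • cableDir w j) - cableLen w j • cableDir v j

theorem quadPosMixed_comm (w v : Ambient) (j : Fin 4) : quadPosMixed w v j = quadPosMixed v w j := by
  simp only [quadPosMixed]
  abel

theorem _root_.HasDerivWithinAt.quadPosDiff (P : Params) (hx : HasDerivWithinAt x x' s t)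
    (hw : HasDerivWithinAt w w' s t) (j : Fin 4) :
    HasDerivWithinAt (fun τ => QuadLoad.quadPosDiff P (x τ) (w τ) j)
      (QuadLoad.quadPosDiff P (x t) w' j + quadPosMixed x' (w t) j) s t := by
  refine (((hw.loadPos.add (hw.loadAtt.mulVec_const (P.r j))).sub
    ((hw.cableLen j).smul (hx.cableDir j))).sub
    ((hx.cableLen j).smul (hw.cableDir j))).congr_deriv ?_
  simp only [QuadLoad.quadPosDiff, quadPosMixed]
  abel

theorem dot_symm_mulVec {J : Mat} (hJ : J.PosDef) (v w : Vec) : v ⬝ᵥ J *ᵥ w = w ⬝ᵥ J *ᵥ v := by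
  have h : Jᵀ = J := hJ.isHermitian
  rw [Matrix.dotProduct_mulVec, ← Matrix.mulVec_transpose, h, dotProduct_comm]

theorem hasDerivWithinAt_half_quadratic {J : Mat} (hJ : J.PosDef) {v : ℝ → Vec} {v' : Vec}
    (hv : HasDerivWithinAt v v' s t) :
    HasDerivWithinAt (fun τ => (1 / 2) * (v τ ⬝ᵥ J *ᵥ v τ)) (v' ⬝ᵥ J *ᵥ v t) s t := by
  refine ((hv.dot (hv.const_mulVec J)).const_mul (1 / 2)).congr_deriv ?_
  rw [dot_symm_mulVec hJ (v t) v']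
  ring

theorem hasDerivWithinAt_half_sq {v : ℝ → Vec} {v' : Vec} (m : ℝ)
    (hv : HasDerivWithinAt v v' s t) :
    HasDerivWithinAt (fun τ => (1 / 2) * m * (v τ ⬝ᵥ v τ)) (m * (v' ⬝ᵥ v t)) s t := by
  refine ((hv.dot hv).const_mul (1 / 2 * m)).congr_deriv ?_
  rw [dotProduct_comm (v t) v']
  ring

/-- The differential of the Lagrangian at `(x, w)` applied to `(x', w')`. -/
def lagrangianDiff (P : Params) (x w x' w' : Ambient) : ℝ :=
  P.mL * (loadPos w' ⬝ᵥ loadPos w)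
    + ∑ j, P.mQ * ((quadPosDiff P x w' j + quadPosMixed x' w j) ⬝ᵥ quadPosDiff P x w j)
    + (bodyVel (loadAtt x') (loadAtt w) + bodyVel (loadAtt x) (loadAtt w')) ⬝ᵥ
        P.JL *ᵥ bodyVel (loadAtt x) (loadAtt w)
    + ∑ j, (bodyVel (quadAtt x' j) (quadAtt w j) + bodyVel (quadAtt x j) (quadAtt w' j)) ⬝ᵥ
        P.JQ *ᵥ bodyVel (quadAtt x j) (quadAtt w j)
    - (P.mL * P.g * (e3 ⬝ᵥ loadPos x')
      + ∑ j, (P.mQ * P.g * (e3 ⬝ᵥ quadPosDiff P x x' j)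
        - P.k * (P.L - cableLen x j) * cableLen x' j))

/-- Here `w` is an independent curve, not the derivative of `x`: along the variation parameter,
position and velocity vary as a pair. -/
theorem _root_.HasDerivWithinAt.lagrangian (P : Params) (hx : HasDerivWithinAt x x' s t)
    (hw : HasDerivWithinAt w w' s t) :
    HasDerivWithinAt (fun τ => lagrangian P (x τ) (w τ)) (lagrangianDiff P (x t) (w t) x' w')
      s t := by
  have he : ∀ {v : ℝ → Vec} {v' : Vec} (m : ℝ), HasDerivWithinAt v v' s t →
      HasDerivWithinAt (fun τ => m * (e3 ⬝ᵥ v τ)) (m * (e3 ⬝ᵥ v')) s t := fun m hv =>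
    (((hasDerivWithinAt_const t s e3).dot hv).const_mul m).congr_deriv (by rw [zero_dotProduct, zero_add])
  refine ((((hasDerivWithinAt_half_sq P.mL hw.loadPos).add
    (HasDerivWithinAt.fun_sum fun j _ =>
      hasDerivWithinAt_half_sq P.mQ (hx.quadPosDiff P hw j))).add
    (hasDerivWithinAt_half_quadratic P.JL_posDef (hx.loadAtt.bodyVel hw.loadAtt))).add
    (HasDerivWithinAt.fun_sum fun j _ =>
      hasDerivWithinAt_half_quadratic P.JQ_posDef ((hx.quadAtt j).bodyVel (hw.quadAtt j)))).sub
    ((he (P.mL * P.g) hx.loadPos).add (HasDerivWithinAt.fun_sum fun j _ =>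
      ((he (P.mQ * P.g) (hx.quadPos P j)).add
        ((((hx.cableLen j).const_sub P.L).pow 2).const_mul ((1 / 2) * P.k))).congr_deriv ?_))
  push_cast
  ring

end Ambient

end Deriv

/-! ### Differentiation on a strip -/

section Strip

variable {E : Type*} [NormedAddCommGroup E] [NormedSpace ℝ E] {ε T : ℝ} {G : ℝ × ℝ → E} {p : ℝ × ℝ}

/-- The domain `(-ε, ε) × [0, T]` of a variation. -/
def strip (ε T : ℝ) : Set (ℝ × ℝ) := Ioo (-ε) ε ×ˢ Icc 0 T

theorem uniqueDiffOn_strip (hT : 0 < T) : UniqueDiffOn ℝ (strip ε T) :=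
  isOpen_Ioo.uniqueDiffOn.prod (uniqueDiffOn_Icc hT)

/-- The edges `t = 0` and `t = T` are not interior points, and symmetry of the second derivative
within a set asks for this condition instead. -/
theorem mem_closure_interior_strip (hT : 0 < T) (hp : p ∈ strip ε T) :
    p ∈ closure (interior (strip ε T)) := by
  rw [strip, interior_prod_eq, closure_prod_eq, interior_Icc, closure_Ioo hT.ne, isOpen_Ioo.interior_eq]
  exact ⟨subset_closure hp.1, hp.2⟩

/-- The derivative in the variation parameter. -/
def partialS (ε T : ℝ) (G : ℝ × ℝ → E) (p : ℝ × ℝ) : E := fderivWithin ℝ G (strip ε T) p (1, 0)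

/-- The derivative in time. -/
def partialT (ε T : ℝ) (G : ℝ × ℝ → E) (p : ℝ × ℝ) : E := fderivWithin ℝ G (strip ε T) p (0, 1)

theorem contDiffOn_fderivWithin_strip (hT : 0 < T) (hG : ContDiffOn ℝ ∞ G (strip ε T)) :
    ContDiffOn ℝ ∞ (fderivWithin ℝ G (strip ε T)) (strip ε T) :=
  hG.fderivWithin (uniqueDiffOn_strip hT) (by simp)

theorem contDiffOn_partialS (hT : 0 < T) (hG : ContDiffOn ℝ ∞ G (strip ε T)) :
    ContDiffOn ℝ ∞ (partialS ε T G) (strip ε T) :=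
  (contDiffOn_fderivWithin_strip hT hG).clm_apply contDiffOn_const

theorem contDiffOn_partialT (hT : 0 < T) (hG : ContDiffOn ℝ ∞ G (strip ε T)) :
    ContDiffOn ℝ ∞ (partialT ε T G) (strip ε T) :=
  (contDiffOn_fderivWithin_strip hT hG).clm_apply contDiffOn_const

theorem hasDerivAt_partialS (hG : ContDiffOn ℝ ∞ G (strip ε T)) (hp : p ∈ strip ε T) :
    HasDerivAt (fun s => G (s, p.2)) (partialS ε T G p) p.1 := by
  have h1 := ((hG.differentiableOn (by simp)) p hp).hasFDerivWithinAt
  have h2 : HasDerivWithinAt (fun s : ℝ => (s, p.2)) ((1 : ℝ), (0 : ℝ)) (Ioo (-ε) ε) p.1 :=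
    ((hasDerivAt_id _).prodMk (hasDerivAt_const _ _)).hasDerivWithinAt
  have h3 : MapsTo (fun s : ℝ => (s, p.2)) (Ioo (-ε) ε) (strip ε T) := fun s hs => ⟨hs, hp.2⟩
  exact (h1.comp_hasDerivWithinAt p.1 h2 h3).hasDerivAt
    (isOpen_Ioo.mem_nhds hp.1)

theorem hasDerivWithinAt_partialT (hG : ContDiffOn ℝ ∞ G (strip ε T)) (hp : p ∈ strip ε T) :
    HasDerivWithinAt (fun t => G (p.1, t)) (partialT ε T G p) (Icc 0 T) p.2 := by
  have h1 := ((hG.differentiableOn (by simp)) p hp).hasFDerivWithinAt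
  have h2 : HasDerivWithinAt (fun t : ℝ => (p.1, t)) ((0 : ℝ), (1 : ℝ)) (Icc 0 T) p.2 :=
    ((hasDerivAt_const _ _).prodMk (hasDerivAt_id _)).hasDerivWithinAt
  have h3 : MapsTo (fun t : ℝ => (p.1, t)) (Icc 0 T) (strip ε T) := fun s hs => ⟨hp.1, hs⟩
  exact h1.comp_hasDerivWithinAt p.2 h2 h3

/-- Schwarz's theorem, valid up to the edges of the strip: the variation of the velocity is the
velocity of the variation. -/
theorem partialS_partialT (hT : 0 < T) (hG : ContDiffOn ℝ ∞ G (strip ε T)) (hp : p ∈ strip ε T) :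
    partialS ε T (partialT ε T G) p = partialT ε T (partialS ε T G) p := by
  have hd := ((contDiffOn_fderivWithin_strip hT hG).differentiableOn (by simp)) p hp
  have hu := uniqueDiffOn_strip hT p hp
  have hs := (hG p hp).isSymmSndFDerivWithinAt
    (by rw [minSmoothness_of_isRCLikeNormedField]; exact WithTop.coe_le_coe.2 le_top) (uniqueDiffOn_strip hT)
    (mem_closure_interior_strip hT hp) hp
  -- Differentiating a directional derivative with fixed direction gives the second derivative
  -- evaluated on both directions.
  have key : ∀ v w : ℝ × ℝ, fderivWithin ℝ (fun q => fderivWithin ℝ G (strip ε T) q v) (strip ε T) p w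
      = fderivWithin ℝ (fderivWithin ℝ G (strip ε T)) (strip ε T) p w v := fun v w => by
    have := (hd.hasFDerivWithinAt.clm_apply (hasFDerivWithinAt_const v p (strip ε T))).fderivWithin hu
    rw [this]
    simp
  exact (key _ _).trans ((hs _ _).trans (key _ _).symm)

/-- Differentiation under the integral sign. -/
theorem hasDerivAt_integral_strip (hT : 0 < T) (hε : 0 < ε) {G : ℝ × ℝ → ℝ}
    (hG : ContDiffOn ℝ ∞ G (strip ε T)) :
    HasDerivAt (fun s => ∫ t in (0 : ℝ)..T, G (s, t)) (∫ t in (0 : ℝ)..T, partialS ε T G (0, t)) 0 := by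
  have hIcc : uIoc 0 T ⊆ Icc 0 T := by
    rw [uIoc_of_le hT.le]; exact Ioc_subset_Icc_self
  have hslice : ∀ {H : ℝ × ℝ → ℝ}, ContDiffOn ℝ ∞ H (strip ε T) → ∀ s ∈ Ioo (-ε) ε,
      ContinuousOn (fun t => H (s, t)) (Icc 0 T) := fun hH s hs =>
    hH.continuousOn.comp (by fun_prop) fun t ht => ⟨hs, ht⟩
  have h0 : (0 : ℝ) ∈ Ioo (-ε) ε := ⟨by linarith, hε⟩
  have hS := contDiffOn_partialS hT hG
  have hsub : Icc (-(ε / 2)) (ε / 2) ⊆ Ioo (-ε) ε := fun s hs =>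
    ⟨by linarith [hs.1], by linarith [hs.2]⟩
  -- Halving the width makes the strip compact, so a constant dominates the derivative of the
  -- integrand.
  obtain ⟨C, hC⟩ := (isCompact_Icc.prod isCompact_Icc :
    IsCompact (Icc (-(ε / 2)) (ε / 2) ×ˢ Icc 0 T)).exists_bound_of_continuousOn
      (hS.continuousOn.mono (prod_mono hsub subset_rfl))
  refine (intervalIntegral.hasDerivAt_integral_of_dominated_loc_of_deriv_le (μ := volume)
    (s := Icc (-(ε / 2)) (ε / 2)) (bound := fun _ => C) (F := fun s t => G (s, t))
    (F' := fun s t => partialS ε T G (s, t))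
    (Icc_mem_nhds (by linarith) (by linarith)) ?_ ?_ ?_ ?_ ?_ ?_).2
  · filter_upwards [isOpen_Ioo.mem_nhds h0] with s hs
    exact ((hslice hG s hs).mono hIcc).aestronglyMeasurable measurableSet_uIoc
  · exact ContinuousOn.intervalIntegrable (by rw [uIcc_of_le hT.le]; exact hslice hG 0 h0)
  · exact ((hslice hS 0 h0).mono hIcc).aestronglyMeasurable measurableSet_uIoc
  · exact Filter.Eventually.of_forall fun t ht s hs => hC (s, t) ⟨hs, hIcc ht⟩
  · exact intervalIntegrable_const
  · exact Filter.Eventually.of_forall fun t ht s hs =>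
      hasDerivAt_partialS hG (p := (s, t)) ⟨hsub hs, hIcc ht⟩

end Strip

/-- In the ambient coordinates the Lagrangian is a polynomial, because `bodyVel` uses the transpose
of `R` and not its inverse. -/
theorem contDiff_lagrangian (P : Params) :
    ContDiff ℝ ∞ (fun p : Ambient × Ambient => lagrangian P p.1 p.2) := by
  simp only [lagrangian, kinetic, potential, bodyVel, vee, quadPosDiff, quadPos, loadPos, loadAtt,
    cableDir, cableLen, quadAtt, dotProduct, Fin.sum_univ_three, Fin.sum_univ_four, Matrix.mulVec,
    Matrix.mul_apply, Matrix.transpose_apply, Pi.add_apply, Pi.sub_apply, Pi.smul_apply,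
    smul_eq_mul, Matrix.cons_val]
  fun_prop

/-! ### The first variation -/

section FirstVariation

variable {T : ℝ} {γ : ℝ → Ambient}

/-- The velocity of the load along a curve. -/
def loadVel (T : ℝ) (γ : ℝ → Ambient) (t : ℝ) : Vec := loadPos (ddt T γ t)

/-- The body angular velocity of the load along a curve. -/
def loadAngVel (T : ℝ) (γ : ℝ → Ambient) (t : ℝ) : Vec :=
  bodyVel (loadAtt (γ t)) (loadAtt (ddt T γ t))

/-- The body angular velocity of the quadrotor `j` along a curve. -/
def quadAngVel (T : ℝ) (γ : ℝ → Ambient) (j : Fin 4) (t : ℝ) : Vec :=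
  bodyVel (quadAtt (γ t) j) (quadAtt (ddt T γ t) j)

/-- The velocity of the quadrotor `j` along a curve. -/
def quadVel (P : Params) (T : ℝ) (γ : ℝ → Ambient) (j : Fin 4) (t : ℝ) : Vec :=
  quadPosDiff P (γ t) (ddt T γ t) j

/-- The balance of forces and moments on the infinitesimal variation `v` at time `t`. -/
def balance (P : Params) (T : ℝ) (f : Fin 4 → ℝ → ℝ) (M : Fin 4 → ℝ → Vec) (γ : ℝ → Ambient)
    (t : ℝ) (v : Ambient) : ℝ :=
  (-(P.mL • (ddt T (loadVel T γ) t + P.g • e3))) ⬝ᵥ loadPos v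
    + ∑ j, (thrust f γ j t - P.mQ • (ddt T (quadVel P T γ j) t + P.g • e3)) ⬝ᵥ
        quadPosDiff P (γ t) v j
    + bodyVel (loadAtt (γ t)) (loadAtt v) ⬝ᵥ
        ((P.JL *ᵥ loadAngVel T γ t) ⨯₃ loadAngVel T γ t - P.JL *ᵥ ddt T (loadAngVel T γ) t)
    + ∑ j, bodyVel (quadAtt (γ t) j) (quadAtt v j) ⬝ᵥ
        ((P.JQ *ᵥ quadAngVel T γ j t) ⨯₃ quadAngVel T γ j t + M j t
          - P.JQ *ᵥ ddt T (quadAngVel T γ j) t)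
    + ∑ j, (P.k * (P.L - cableLen (γ t) j) - P.c * cableLen (ddt T γ t) j) * cableLen v j

/-- The momentum paired with an infinitesimal variation. -/
def momentum (P : Params) (T : ℝ) (γ δ : ℝ → Ambient) (t : ℝ) : ℝ :=
  P.mL * (loadVel T γ t ⬝ᵥ loadPos (δ t))
    + ∑ j, P.mQ * (quadVel P T γ j t ⬝ᵥ quadPosDiff P (γ t) (δ t) j)
    + bodyVel (loadAtt (γ t)) (loadAtt (δ t)) ⬝ᵥ P.JL *ᵥ loadAngVel T γ t
    + ∑ j, bodyVel (quadAtt (γ t) j) (quadAtt (δ t) j) ⬝ᵥ P.JQ *ᵥ quadAngVel T γ j t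

theorem contDiffOn_ddt {E : Type*} [NormedAddCommGroup E] [NormedSpace ℝ E] {h : ℝ → E}
    (hT : 0 < T) (hh : ContDiffOn ℝ ∞ h (Icc 0 T)) : ContDiffOn ℝ ∞ (ddt T h) (Icc 0 T) :=
  hh.derivWithin (uniqueDiffOn_Icc hT) (by simp)

theorem _root_.ContDiffOn.hasDerivWithinAt_ddt {E : Type*} [NormedAddCommGroup E] [NormedSpace ℝ E]
    {h : ℝ → E} (hh : ContDiffOn ℝ ∞ h (Icc 0 T)) {t : ℝ} (ht : t ∈ Icc 0 T) :
    HasDerivWithinAt h (ddt T h t) (Icc 0 T) t :=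
  (hh.differentiableOn (by simp) t ht).hasDerivWithinAt

theorem contDiff_bodyVel : ContDiff ℝ ∞ (fun p : Mat × Mat => bodyVel p.1 p.2) := by
  refine contDiff_pi.2 fun i => ?_
  fin_cases i <;>
  · simp [bodyVel, vee, Matrix.mul_apply]
    fun_prop

theorem contDiffOn_loadVel (hT : 0 < T) (hγ : ContDiffOn ℝ ∞ γ (Icc 0 T)) :
    ContDiffOn ℝ ∞ (loadVel T γ) (Icc 0 T) :=
  (contDiff_fst.snd : ContDiff ℝ ∞ loadPos).comp_contDiffOn (contDiffOn_ddt hT hγ)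

theorem contDiff_loadAtt : ContDiff ℝ ∞ loadAtt := contDiff_fst.fst

theorem contDiff_quadAtt (j : Fin 4) : ContDiff ℝ ∞ (fun x : Ambient => quadAtt x j) := by
  simp only [quadAtt]
  fun_prop

theorem contDiffOn_loadAngVel (hT : 0 < T) (hγ : ContDiffOn ℝ ∞ γ (Icc 0 T)) :
    ContDiffOn ℝ ∞ (loadAngVel T γ) (Icc 0 T) :=
  contDiff_bodyVel.comp_contDiffOn ((contDiff_loadAtt.comp_contDiffOn hγ).prodMk
    (contDiff_loadAtt.comp_contDiffOn (contDiffOn_ddt hT hγ)))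

theorem contDiffOn_quadAngVel (hT : 0 < T) (hγ : ContDiffOn ℝ ∞ γ (Icc 0 T)) (j : Fin 4) :
    ContDiffOn ℝ ∞ (quadAngVel T γ j) (Icc 0 T) :=
  contDiff_bodyVel.comp_contDiffOn (((contDiff_quadAtt j).comp_contDiffOn hγ).prodMk
    ((contDiff_quadAtt j).comp_contDiffOn (contDiffOn_ddt hT hγ)))

theorem contDiffOn_quadVel (P : Params) (hT : 0 < T) (hγ : ContDiffOn ℝ ∞ γ (Icc 0 T))
    (j : Fin 4) : ContDiffOn ℝ ∞ (quadVel P T γ j) (Icc 0 T) := by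
  have h : ContDiff ℝ ∞ (fun p : Ambient × Ambient => quadPosDiff P p.1 p.2 j) := by
    refine contDiff_pi.2 fun i => ?_
    simp only [quadPosDiff, loadPos, loadAtt, cableDir, cableLen, Matrix.mulVec, dotProduct,
      Pi.add_apply, Pi.sub_apply, Pi.smul_apply, smul_eq_mul]
    fun_prop
  exact h.comp_contDiffOn (hγ.prodMk (contDiffOn_ddt hT hγ))

/-- The derivative of the kinetic momentum of a rotating body. -/
theorem hasDerivWithinAt_angular_momentum {J : Mat} {R S X : ℝ → Mat} {X' : Mat} {Ω' : Vec}
    {s : Set ℝ} {t : ℝ} (hR : HasDerivWithinAt R (S t) s t) (hX : HasDerivWithinAt X X' s t)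
    (hΩ : HasDerivWithinAt (fun τ => bodyVel (R τ) (S τ)) Ω' s t) (h1 : (R t)ᵀ * R t = 1)
    (hSt : IsOrthTangent (R t) (S t)) (hXt : IsOrthTangent (R t) (X t)) :
    HasDerivWithinAt (fun τ => bodyVel (R τ) (X τ) ⬝ᵥ J *ᵥ bodyVel (R τ) (S τ))
      ((bodyVel (X t) (S t) + bodyVel (R t) X') ⬝ᵥ J *ᵥ bodyVel (R t) (S t)
        - bodyVel (R t) (X t) ⬝ᵥ
          ((J *ᵥ bodyVel (R t) (S t)) ⨯₃ bodyVel (R t) (S t) - J *ᵥ Ω')) s t := by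
  refine ((hR.bodyVel hX).dot (hΩ.const_mulVec J)).congr_deriv ?_
  have h2 := bodyVel_sub_bodyVel hSt hXt h1
  -- The product rule yields `bodyVel S X`, whereas the differential of the Lagrangian contains
  -- `bodyVel X S`. They differ by `Ω × η`, whose pairing with `JΩ` is, by the triple product, `η ⬝
  -- (JΩ × Ω)`.
  have h3 : bodyVel (X t) (S t) = bodyVel (S t) (X t) + bodyVel (R t) (S t) ⨯₃ bodyVel (R t) (X t) := by
    rw [← h2]; abel
  rw [h3]
  have h4 : (bodyVel (R t) (S t) ⨯₃ bodyVel (R t) (X t)) ⬝ᵥ J *ᵥ bodyVel (R t) (S t) =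
      bodyVel (R t) (X t) ⬝ᵥ ((J *ᵥ bodyVel (R t) (S t)) ⨯₃ bodyVel (R t) (S t)) := by
    rw [dotProduct_comm, triple_product_permutation, triple_product_permutation]
  simp only [add_dotProduct, dotProduct_sub, h4]
  ring_nf

/-- Integration by parts in pointwise form. Tangency of `δ` is needed only for the rotations: the
quadrotor position is polynomial in the ambient coordinates, and its mixed second differential is
symmetric, so these terms match directly. -/
theorem hasDerivWithinAt_momentum (P : Params) (f : Fin 4 → ℝ → ℝ) (M : Fin 4 → ℝ → Vec)
    (hT : 0 < T) (hγ : ContDiffOn ℝ ∞ γ (Icc 0 T)) (hQ : ∀ t ∈ Icc 0 T, γ t ∈ Q) {t : ℝ}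
    (ht : t ∈ Icc 0 T) {δ : ℝ → Ambient} {δ' : Ambient} (hδ : HasDerivWithinAt δ δ' (Icc 0 T) t)
    (hL : IsOrthTangent (loadAtt (γ t)) (loadAtt (δ t)))
    (hR : ∀ j, IsOrthTangent (quadAtt (γ t) j) (quadAtt (δ t) j)) :
    HasDerivWithinAt (momentum P T γ δ)
      (lagrangianDiff P (γ t) (ddt T γ t) (δ t) δ' + virtualWork P T f M γ δ t
        - balance P T f M γ t (δ t)) (Icc 0 T) t := by
  have hu := uniqueDiffOn_Icc hT t ht
  have h1 := hγ.hasDerivWithinAt_ddt ht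
  have hLo : ∀ τ ∈ Icc 0 T, (loadAtt (γ τ))ᵀ * loadAtt (γ τ) = 1 := fun τ hτ =>
    transpose_mul_self_of_mem (hQ τ hτ).1
  have hRo : ∀ j, ∀ τ ∈ Icc 0 T, (quadAtt (γ τ) j)ᵀ * quadAtt (γ τ) j = 1 := fun j τ hτ =>
    transpose_mul_self_of_mem ((hQ τ hτ).2.2 j)
  have pos := (((contDiffOn_loadVel hT hγ).hasDerivWithinAt_ddt ht).dot hδ.loadPos).const_mul P.mL
  have quad := fun j => (((contDiffOn_quadVel P hT hγ j).hasDerivWithinAt_ddt ht).dot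
    (h1.quadPosDiff P hδ j)).const_mul P.mQ
  have att := hasDerivWithinAt_angular_momentum (J := P.JL) h1.loadAtt hδ.loadAtt
    ((contDiffOn_loadAngVel hT hγ).hasDerivWithinAt_ddt ht) (hLo t ht)
    (isOrthTangent_of_hasDerivWithinAt h1.loadAtt hu ht hLo) hL
  have quadatt := fun j => hasDerivWithinAt_angular_momentum (J := P.JQ) (h1.quadAtt j)
    (hδ.quadAtt j) ((contDiffOn_quadAngVel hT hγ j).hasDerivWithinAt_ddt ht) (hRo j t ht)
    (isOrthTangent_of_hasDerivWithinAt (h1.quadAtt j) hu ht (hRo j)) (hR j)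
  refine (((pos.add (HasDerivWithinAt.fun_sum fun j _ => quad j)).add att).add
    (HasDerivWithinAt.fun_sum fun j _ => quadatt j)).congr_deriv ?_
  simp only [lagrangianDiff, virtualWork, balance, fun j => skewInner_transpose_mul_hat (hR j), loadVel, quadVel,
    quadPosMixed_comm (δ t), loadAngVel, quadAngVel]
  simp only [dotProduct_comm _ (quadPosDiff P (γ t) (ddt T γ t) _),
    dotProduct_comm _ (loadPos (ddt T γ t)), dotProduct_comm _ (thrust f γ _ t),
    neg_dotProduct, smul_dotProduct, add_dotProduct, sub_dotProduct, dotProduct_add, dotProduct_sub,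
    smul_eq_mul, mul_add, mul_sub, sub_mul,
    Finset.sum_add_distrib, Finset.sum_sub_distrib]
  ring_nf

end FirstVariation

/-! ### Continuity of the integrands -/

section Critical

variable {P : Params} {T : ℝ} {f : Fin 4 → ℝ → ℝ} {M : Fin 4 → ℝ → Vec} {a b : Ambient}
  {γ : ℝ → Ambient}

section Products

variable {s : Set ℝ} {u v : ℝ → Vec} {A B : ℝ → Mat}

@[fun_prop]
theorem _root_.ContinuousOn.dot (hu : ContinuousOn u s) (hv : ContinuousOn v s) :
    ContinuousOn (fun t => u t ⬝ᵥ v t) s :=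
  (continuous_fst.dotProduct continuous_snd : Continuous fun p : Vec × Vec => p.1 ⬝ᵥ p.2)
    |>.comp_continuousOn (hu.prodMk hv)

@[fun_prop]
theorem _root_.ContinuousOn.mat_mulVec (hA : ContinuousOn A s) (hv : ContinuousOn v s) :
    ContinuousOn (fun t => A t *ᵥ v t) s :=
  (continuous_fst.matrix_mulVec continuous_snd : Continuous fun p : Mat × Vec => p.1 *ᵥ p.2)
    |>.comp_continuousOn (hA.prodMk hv)

theorem _root_.ContinuousOn.crossProd (hu : ContinuousOn u s) (hv : ContinuousOn v s) :
    ContinuousOn (fun t => u t ⨯₃ v t) s := by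
  have h : Continuous fun p : Vec × Vec => p.1 ⨯₃ p.2 := by
    simp only [cross_apply]
    fun_prop
  exact h.comp_continuousOn (hu.prodMk hv)

@[fun_prop]
theorem continuousOn_bodyVel (hA : ContinuousOn A s) (hB : ContinuousOn B s) :
    ContinuousOn (fun t => bodyVel (A t) (B t)) s := by
  refine continuousOn_pi.2 fun i => ?_
  fin_cases i <;>
  · simp only [bodyVel, vee, Matrix.mul_apply, Matrix.transpose_apply, Fin.sum_univ_three,
      Fin.zero_eta, Fin.mk_one, Fin.reduceFinMk, Matrix.cons_val]
    fun_prop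

@[fun_prop]
theorem _root_.ContinuousOn.skewInner_hat (hA : ContinuousOn A s) (hB : ContinuousOn B s)
    (hv : ContinuousOn v s) :
    ContinuousOn (fun t => skewInner ((A t)ᵀ * B t) (hat (v t))) s := by
  simp only [skewInner, hat, Matrix.trace_fin_three, Matrix.mul_apply, Fin.sum_univ_three,
    Matrix.transpose_apply]
  simp only [Matrix.of_apply, Matrix.cons_val, Matrix.cons_val', Matrix.cons_val_zero]
  fun_prop

end Products

theorem continuousOn_thrust (hf : ∀ j, ContinuousOn (f j) (Icc 0 T))
    (hγ : ContinuousOn γ (Icc 0 T)) (j : Fin 4) : ContinuousOn (thrust f γ j) (Icc 0 T) := by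
  unfold thrust quadAtt
  fun_prop

theorem continuousOn_quadPosDiff {δ : ℝ → Ambient} (hγ : ContinuousOn γ (Icc 0 T))
    (hδ : ContinuousOn δ (Icc 0 T)) (j : Fin 4) :
    ContinuousOn (fun t => quadPosDiff P (γ t) (δ t) j) (Icc 0 T) := by
  simp only [quadPosDiff, loadPos, loadAtt, cableLen, cableDir]
  fun_prop

theorem continuousOn_virtualWork (hT : 0 < T) (hf : ∀ j, ContinuousOn (f j) (Icc 0 T))
    (hM : ∀ j, ContinuousOn (M j) (Icc 0 T)) (hγ : ContDiffOn ℝ ∞ γ (Icc 0 T))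
    {δ : ℝ → Ambient} (hδ : ContinuousOn δ (Icc 0 T)) :
    ContinuousOn (virtualWork P T f M γ δ) (Icc 0 T) := by
  have h1 := hγ.continuousOn
  have h2 := continuousOn_thrust hf h1
  have h3 := (contDiffOn_ddt hT hγ).continuousOn
  have h4 := continuousOn_quadPosDiff (P := P) h1 hδ
  unfold virtualWork quadAtt cableLen
  simp only [Fin.sum_univ_four]
  fun_prop

theorem continuousOn_balance (hT : 0 < T) (hf : ∀ j, ContinuousOn (f j) (Icc 0 T))
    (hM : ∀ j, ContinuousOn (M j) (Icc 0 T)) (hγ : ContDiffOn ℝ ∞ γ (Icc 0 T))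
    {δ : ℝ → Ambient} (hδ : ContinuousOn δ (Icc 0 T)) :
    ContinuousOn (fun t => balance P T f M γ t (δ t)) (Icc 0 T) := by
  have h1 := hγ.continuousOn
  have h2 := continuousOn_thrust hf h1
  have h3 := (contDiffOn_ddt hT hγ).continuousOn
  have h4 := continuousOn_quadPosDiff (P := P) h1 hδ
  have h5 := (contDiffOn_ddt hT (contDiffOn_loadVel hT hγ)).continuousOn
  have h6 := fun j => (contDiffOn_ddt hT (contDiffOn_quadVel P hT hγ j)).continuousOn
  have h7 := (contDiffOn_loadAngVel hT hγ).continuousOn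
  have h8 := (contDiffOn_ddt hT (contDiffOn_loadAngVel hT hγ)).continuousOn
  have h9 := fun j => (contDiffOn_quadAngVel hT hγ j).continuousOn
  have h10 := fun j => (contDiffOn_ddt hT (contDiffOn_quadAngVel hT hγ j)).continuousOn
  have h11 := (continuousOn_const.mat_mulVec h7 (A := fun _ => P.JL)).crossProd h7
  have h12 := fun j => (continuousOn_const.mat_mulVec (h9 j) (A := fun _ => P.JQ)).crossProd (h9 j)
  have h13 : ContinuousOn (fun t => loadAtt (γ t)) (Icc 0 T) := by
    unfold loadAtt; fun_prop
  have h14 : ContinuousOn (fun t => loadAtt (δ t)) (Icc 0 T) := by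
    unfold loadAtt; fun_prop
  have h15 : ∀ j, ContinuousOn (fun t => quadAtt (γ t) j) (Icc 0 T) := by
    unfold quadAtt; fun_prop
  have h16 : ∀ j, ContinuousOn (fun t => quadAtt (δ t) j) (Icc 0 T) := by
    unfold quadAtt; fun_prop
  refine ((((?_ : ContinuousOn _ _).add (continuousOn_finsetSum _ fun j _ => ?_)).add ?_).add
    (continuousOn_finsetSum _ fun j _ => ?_)).add (continuousOn_finsetSum _ fun j _ => ?_)
  · unfold loadPos; fun_prop
  · exact ((h2 j).sub ((((h6 j).add continuousOn_const)).const_smul P.mQ)).dot (h4 j)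
  · exact (continuousOn_bodyVel h13 h14).dot (h11.sub (continuousOn_const.mat_mulVec h8))
  · exact (continuousOn_bodyVel (h15 j) (h16 j)).dot
      (((h12 j).add (hM j)).sub (continuousOn_const.mat_mulVec (h10 j)))
  · unfold cableLen; fun_prop

theorem momentum_of_eq_zero {δ : ℝ → Ambient} {t : ℝ} (h : δ t = 0) : momentum P T γ δ t = 0 := by
  have h1 : ∀ R : Mat, bodyVel R 0 = 0 := fun R => by
    ext i
    fin_cases i <;> simp [bodyVel, vee]
  simp [momentum, h, loadPos, loadAtt, quadAtt, quadPosDiff, cableLen, cableDir, h1]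

end Critical

/-! ### Criticality as vanishing of the integrated balance -/

section Critical

variable {P : Params} {T : ℝ} {f : Fin 4 → ℝ → ℝ} {M : Fin 4 → ℝ → Vec} {a b : Ambient}
  {γ : ℝ → Ambient}


/-- Integrate the derivative of `momentum` over `[0, T]`; the boundary terms are zero because the
endpoints are fixed. -/
theorem IsVariation.exists_hasDerivAt_action (hT : 0 < T) (hf : ∀ j, ContinuousOn (f j) (Icc 0 T))
    (hM : ∀ j, ContinuousOn (M j) (Icc 0 T)) (hγ : IsCurve T a b γ) {ε : ℝ} {Γ : ℝ → ℝ → Ambient}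
    (hΓ : IsVariation T a b γ ε Γ) :
    ∃ dA : ℝ, HasDerivAt (fun s => action P T (Γ s)) dA 0 ∧
      dA + ∫ t in (0 : ℝ)..T, virtualWork P T f M γ (fun τ => deriv (fun s => Γ s τ) 0) t =
        ∫ t in (0 : ℝ)..T, balance P T f M γ t (deriv (fun s => Γ s t) 0) := by
  set G : ℝ × ℝ → Ambient := fun p => Γ p.1 p.2 with hGdef
  have hG : ContDiffOn ℝ ∞ G (strip ε T) := hΓ.smooth
  have h0 : (0 : ℝ) ∈ Ioo (-ε) ε := ⟨by linarith [hΓ.pos], hΓ.pos⟩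
  have hS := contDiffOn_partialS hT hG
  have hTt := contDiffOn_partialT hT hG
  have hslice : ∀ {E : Type} [NormedAddCommGroup E] [NormedSpace ℝ E] {H : ℝ × ℝ → E},
      ContDiffOn ℝ ∞ H (strip ε T) → ContDiffOn ℝ ∞ (fun t => H (0, t)) (Icc 0 T) := fun hH =>
    hH.comp (by fun_prop) fun t ht => ⟨h0, ht⟩
  have hddt : ∀ {E : Type} [NormedAddCommGroup E] [NormedSpace ℝ E] {H : ℝ × ℝ → E},
      ContDiffOn ℝ ∞ H (strip ε T) → ∀ s ∈ Ioo (-ε) ε, ∀ t ∈ Icc 0 T,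
      ddt T (fun τ => H (s, τ)) t = partialT ε T H (s, t) := fun hH s hs t ht =>
    (hasDerivWithinAt_partialT hH (p := (s, t)) ⟨hs, ht⟩).derivWithin (uniqueDiffOn_Icc hT t ht)
  set δ : ℝ → Ambient := fun t => partialS ε T G (0, t) with hδdef
  have hδ : ContDiffOn ℝ ∞ δ (Icc 0 T) := hslice hS
  have hs : ∀ t ∈ Icc 0 T, HasDerivAt (fun s => Γ s t) (δ t) 0 := fun t ht =>
    hasDerivAt_partialS hG (p := (0, t)) ⟨h0, ht⟩
  have hderiv : ∀ t ∈ Icc 0 T, deriv (fun s => Γ s t) 0 = δ t := fun t ht => (hs t ht).deriv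
  have hγ0 : ∀ t ∈ Icc 0 T, Γ 0 t = γ t := hΓ.zero
  -- `Γ 0` and `γ` agree only on `[0, T]`, which suffices because `ddt` is a derivative within that
  -- interval.
  have hγ1 : ∀ t ∈ Icc 0 T, partialT ε T G (0, t) = ddt T γ t := fun t ht => by
    rw [← hddt hG 0 h0 t ht]
    exact derivWithin_congr hγ0 (hγ0 t ht)
  set F : ℝ × ℝ → ℝ := fun p => lagrangian P (G p) (partialT ε T G p) with hFdef
  have hF : ContDiffOn ℝ ∞ F (strip ε T) := by
    have h := (contDiff_lagrangian P).comp_contDiffOn (hG.prodMk hTt)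
    exact h
  have hFS : ∀ t ∈ Icc 0 T,
      partialS ε T F (0, t) = lagrangianDiff P (γ t) (ddt T γ t) (δ t) (ddt T δ t) := fun t ht => by
    have hp : ((0 : ℝ), t) ∈ strip ε T := ⟨h0, ht⟩
    have h1 := (hasDerivAt_partialS hG hp).hasDerivWithinAt (s := univ)
    have h2 := (hasDerivAt_partialS hTt hp).hasDerivWithinAt (s := univ)
    have h3 := hasDerivWithinAt_univ.1 (h1.lagrangian P h2)
    rw [(hasDerivAt_partialS hF hp).unique h3, partialS_partialT hT hG hp, ← hddt hS 0 h0 t ht]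
    simp only [hγ1 t ht]
    rw [show G (0, t) = γ t from hγ0 t ht]
  refine ⟨∫ t in (0 : ℝ)..T, partialS ε T F (0, t), ?_, ?_⟩
  · have hact : ∀ s ∈ Ioo (-ε) ε, action P T (Γ s) = ∫ t in (0 : ℝ)..T, F (s, t) := fun s hs => by
      unfold action
      refine intervalIntegral.integral_congr fun t ht => ?_
      rw [uIcc_of_le hT.le] at ht
      have h : ddt T (Γ s) t = partialT ε T G (s, t) := hddt hG s hs t ht
      change lagrangian P (Γ s t) (ddt T (Γ s) t) = lagrangian P (Γ s t) (partialT ε T G (s, t))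
      rw [h]
    have hint := hasDerivAt_integral_strip hT hΓ.pos hF
    exact hint.congr_of_eventuallyEq (Filter.eventually_of_mem (isOpen_Ioo.mem_nhds h0) hact)
  have hI : uIcc 0 T = Icc 0 T := uIcc_of_le hT.le
  have hVW : ContinuousOn (virtualWork P T f M γ δ) (uIcc 0 T) :=
    hI ▸ continuousOn_virtualWork hT hf hM hγ.smooth hδ.continuousOn
  have hB : ContinuousOn (fun t => balance P T f M γ t (δ t)) (uIcc 0 T) :=
    hI ▸ continuousOn_balance hT hf hM hγ.smooth hδ.continuousOn
  have hL : ContinuousOn (fun t => partialS ε T F (0, t)) (uIcc 0 T) :=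
    hI ▸ (hslice (contDiffOn_partialS hT hF)).continuousOn
  have hmom : ∀ t ∈ Icc 0 T, HasDerivWithinAt (momentum P T γ δ)
      (partialS ε T F (0, t) + virtualWork P T f M γ δ t - balance P T f M γ t (δ t))
      (Icc 0 T) t := fun t ht => by
    rw [hFS t ht]
    have hst := (hs t ht).hasDerivWithinAt (s := Ioo (-ε) ε)
    have hu := isOpen_Ioo.uniqueDiffOn (𝕜 := ℝ) 0 h0
    have hmem := fun s hs => (hΓ.curve s hs).mem t ht
    have hL := isOrthTangent_of_hasDerivWithinAt hst.loadAtt hu h0 fun s hs =>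
      transpose_mul_self_of_mem (hmem s hs).1
    have hR := fun j => isOrthTangent_of_hasDerivWithinAt (hst.quadAtt j) hu h0 fun s hs =>
      transpose_mul_self_of_mem ((hmem s hs).2.2 j)
    simp only [hγ0 t ht] at hL hR
    have hδt := hδ.hasDerivWithinAt_ddt ht
    exact hasDerivWithinAt_momentum P f M hT hγ.smooth hγ.mem ht hδt hL hR
  -- A point that stays fixed throughout the variation has zero infinitesimal variation; this is
  -- applied at `0` and `T`.
  have hend : ∀ t ∈ Icc 0 T, (∃ c, ∀ s ∈ Ioo (-ε) ε, Γ s t = c) → δ t = 0 := by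
    rintro t ht ⟨c, hc⟩
    have hev : (fun s => Γ s t) =ᶠ[nhds 0] fun _ => c :=
      Filter.eventually_of_mem (isOpen_Ioo.mem_nhds h0) hc
    have hz : HasDerivAt (fun s => Γ s t) (0 : Ambient) 0 :=
      (hasDerivAt_const (0 : ℝ) c).congr_of_eventuallyEq hev
    exact (hs t ht).unique hz
  have hzero := intervalIntegral.integral_eq_sub_of_hasDerivAt_of_le hT.le
    (fun t ht => (hmom t ht).continuousWithinAt)
    (fun t ht => (hmom t (Ioo_subset_Icc_self ht)).hasDerivAt (Icc_mem_nhds ht.1 ht.2))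
    ((hL.add hVW).sub hB).intervalIntegrable
  have hsub := intervalIntegral.integral_sub (μ := volume) (hL.add hVW).intervalIntegrable
    hB.intervalIntegrable
  have hadd := intervalIntegral.integral_add (μ := volume) hL.intervalIntegrable
    hVW.intervalIntegrable
  simp only [Pi.add_apply] at hsub
  rw [momentum_of_eq_zero (hend 0 ⟨le_rfl, hT.le⟩ ⟨a, fun s hs => (hΓ.curve s hs).left⟩),
    momentum_of_eq_zero (hend T ⟨hT.le, le_rfl⟩ ⟨b, fun s hs => (hΓ.curve s hs).right⟩),
    sub_zero, hsub, hadd] at hzero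
  have e1 : ∫ t in (0 : ℝ)..T, virtualWork P T f M γ (fun τ => deriv (fun s => Γ s τ) 0) t =
      ∫ t in (0 : ℝ)..T, virtualWork P T f M γ δ t :=
    intervalIntegral.integral_congr fun t ht => by
      simp only [virtualWork, hderiv t (hI ▸ ht)]
  have e2 : ∫ t in (0 : ℝ)..T, balance P T f M γ t (deriv (fun s => Γ s t) 0) =
      ∫ t in (0 : ℝ)..T, balance P T f M γ t (δ t) :=
    intervalIntegral.integral_congr fun t ht => by simp only [hderiv t (hI ▸ ht)]
  rw [e1, e2]
  linarith

/-- The derivative of the action always exists, so by uniqueness the existential in `IsCritical`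
reduces to one integral identity. -/
theorem isCritical_iff_integral_balance (hT : 0 < T) (hf : ∀ j, ContinuousOn (f j) (Icc 0 T))
    (hM : ∀ j, ContinuousOn (M j) (Icc 0 T)) (hγ : IsCurve T a b γ) :
    IsCritical P T f M a b γ ↔ ∀ (ε : ℝ) (Γ : ℝ → ℝ → Ambient), IsVariation T a b γ ε Γ →
      ∫ t in (0 : ℝ)..T, balance P T f M γ t (deriv (fun s => Γ s t) 0) = 0 := by
  unfold IsCritical
  refine forall₃_congr fun ε Γ hΓ => ?_
  obtain ⟨dA, h1, h2⟩ := hΓ.exists_hasDerivAt_action (P := P) hT hf hM hγ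
  constructor
  · rintro ⟨dB, h3, h4⟩
    rw [← h2, h1.unique h3, h4]
  · exact fun h => ⟨dA, h1, h2.trans h⟩

end Critical

/-! ### The balance of forces and the Euler–Lagrange equations -/

section Balance

variable {P : Params} {T : ℝ} {f : Fin 4 → ℝ → ℝ} {M : Fin 4 → ℝ → Vec} {a b : Ambient}
  {γ : ℝ → Ambient} {t : ℝ}

/-- The thrust of the quadrotor `j` minus its inertial and gravitational forces. -/
def quadForce (P : Params) (T : ℝ) (f : Fin 4 → ℝ → ℝ) (γ : ℝ → Ambient) (j : Fin 4) (t : ℝ) : Vec :=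
  thrust f γ j t - P.mQ • (ddt T (quadVel P T γ j) t + P.g • e3)

/-- The force balance of the load. -/
def loadForceResidual (P : Params) (T : ℝ) (f : Fin 4 → ℝ → ℝ) (γ : ℝ → Ambient) (t : ℝ) : Vec :=
  (∑ j, quadForce P T f γ j t) - P.mL • (ddt T (loadVel T γ) t + P.g • e3)

/-- The moment balance of the load. -/
def loadMomentResidual (P : Params) (T : ℝ) (f : Fin 4 → ℝ → ℝ) (γ : ℝ → Ambient) (t : ℝ) : Vec :=
  (∑ j, P.r j ⨯₃ ((loadAtt (γ t))ᵀ *ᵥ quadForce P T f γ j t))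
    + ((P.JL *ᵥ loadAngVel T γ t) ⨯₃ loadAngVel T γ t - P.JL *ᵥ ddt T (loadAngVel T γ) t)

/-- The moment balance of the quadrotor `j`. -/
def quadMomentResidual (P : Params) (T : ℝ) (M : Fin 4 → ℝ → Vec) (γ : ℝ → Ambient) (j : Fin 4)
    (t : ℝ) : Vec :=
  (P.JQ *ᵥ quadAngVel T γ j t) ⨯₃ quadAngVel T γ j t + M j t - P.JQ *ᵥ ddt T (quadAngVel T γ j) t

/-- The balance of the forces along the cable `j`. -/
def cableResidual (P : Params) (T : ℝ) (f : Fin 4 → ℝ → ℝ) (γ : ℝ → Ambient) (j : Fin 4) (t : ℝ) :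
    ℝ :=
  P.k * (P.L - cableLen (γ t) j) - P.c * cableLen (ddt T γ t) j
    - cableDir (γ t) j ⬝ᵥ quadForce P T f γ j t

/-- All forces and moments are balanced at time `t`. -/
structure Balanced (P : Params) (T : ℝ) (f : Fin 4 → ℝ → ℝ) (M : Fin 4 → ℝ → Vec)
    (γ : ℝ → Ambient) (t : ℝ) : Prop where
  loadForce : loadForceResidual P T f γ t = 0
  loadMoment : loadMomentResidual P T f γ t = 0
  quadMoment : ∀ j, quadMomentResidual P T M γ j t = 0
  cableLength : ∀ j, cableResidual P T f γ j t = 0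
  cableDirection : ∀ j, cableDir (γ t) j ⨯₃ quadForce P T f γ j t = 0

/-- Expand `δx_{Q_j}` and collect the coefficient of each component of `v`. A force `F` at the
attachment point acts on the load as a moment: `F ⬝ (R η̂ r) = (r × RᵀF) ⬝ η`. -/
theorem balance_eq (hR : (loadAtt (γ t))ᵀ * loadAtt (γ t) = 1) {v : Ambient}
    (hv : IsOrthTangent (loadAtt (γ t)) (loadAtt v)) :
    balance P T f M γ t v =
      loadForceResidual P T f γ t ⬝ᵥ loadPos v
      + loadMomentResidual P T f γ t ⬝ᵥ bodyVel (loadAtt (γ t)) (loadAtt v)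
      + ∑ j, quadMomentResidual P T M γ j t ⬝ᵥ bodyVel (quadAtt (γ t) j) (quadAtt v j)
      + ∑ j, cableResidual P T f γ j t * cableLen v j
      - ∑ j, cableLen (γ t) j * (quadForce P T f γ j t ⬝ᵥ cableDir v j) := by
  have key : ∀ j, quadForce P T f γ j t ⬝ᵥ quadPosDiff P (γ t) v j =
      quadForce P T f γ j t ⬝ᵥ loadPos v
      + (P.r j ⨯₃ ((loadAtt (γ t))ᵀ *ᵥ quadForce P T f γ j t)) ⬝ᵥ
          bodyVel (loadAtt (γ t)) (loadAtt v)
      - (cableDir (γ t) j ⬝ᵥ quadForce P T f γ j t) * cableLen v j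
      - cableLen (γ t) j * (quadForce P T f γ j t ⬝ᵥ cableDir v j) := fun j => by
    have h1 : quadForce P T f γ j t ⬝ᵥ (loadAtt v *ᵥ P.r j) =
        (P.r j ⨯₃ ((loadAtt (γ t))ᵀ *ᵥ quadForce P T f γ j t)) ⬝ᵥ
          bodyVel (loadAtt (γ t)) (loadAtt v) := by
      conv_lhs => rw [← hv.mul_hat hR]
      rw [← Matrix.mulVec_mulVec, Matrix.dotProduct_mulVec, ← Matrix.mulVec_transpose, hat_mulVec,
        triple_product_permutation, dotProduct_comm]
    simp only [quadPosDiff, dotProduct_sub, dotProduct_add, dotProduct_smul, smul_eq_mul, h1]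
    rw [dotProduct_comm (cableDir (γ t) j)]
    ring
  have hF : ∀ j, thrust f γ j t - P.mQ • (ddt T (quadVel P T γ j) t + P.g • e3) =
      quadForce P T f γ j t := fun _ => rfl
  simp only [balance, hF, key, loadForceResidual, loadMomentResidual, cableResidual,
    quadMomentResidual, sub_dotProduct, add_dotProduct, neg_dotProduct, sum_dotProduct, sub_mul,
    dotProduct_comm (bodyVel _ _), Finset.sum_add_distrib, Finset.sum_sub_distrib]
  ring

/-- This is `q × (q × F) = (q ⬝ F) q - (q ⬝ q) F` for a unit vector `q`. -/
theorem eq_dot_smul_of_cross_eq_zero {q F : Vec} (hq : q ⬝ᵥ q = 1) (h : q ⨯₃ F = 0) :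
    F = (q ⬝ᵥ F) • q := by
  have h0 := congrFun h 0
  have h1 := congrFun h 1
  have h2 := congrFun h 2
  simp [cross_apply] at h0 h1 h2
  simp only [dotProduct, Fin.sum_univ_three] at hq ⊢
  ext i
  fin_cases i <;> simp
  · linear_combination (-F 0) * hq - q 1 * h2 + q 2 * h1
  · linear_combination (-F 1) * hq - q 2 * h0 + q 0 * h2
  · linear_combination (-F 2) * hq - q 0 * h1 + q 1 * h0

/-- The force is parallel to the cable and `δq_j` is orthogonal to it, so the cable terms vanish
even where `l_j = 0`. -/
theorem Balanced.balance_eq_zero (h : Balanced P T f M γ t) (hγ : γ t ∈ Q) {v : Ambient}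
    (hv : IsOrthTangent (loadAtt (γ t)) (loadAtt v))
    (hd : ∀ j, cableDir (γ t) j ⬝ᵥ cableDir v j = 0) : balance P T f M γ t v = 0 := by
  rw [balance_eq (transpose_mul_self_of_mem hγ.1) hv, h.loadForce, h.loadMoment]
  have h1 : ∀ j, quadForce P T f γ j t ⬝ᵥ cableDir v j = 0 := fun j => by
    rw [eq_dot_smul_of_cross_eq_zero (hγ.2.1 j) (h.cableDirection j), smul_dotProduct, hd, smul_zero]
  simp only [h.quadMoment, h.cableLength, h1, zero_dotProduct, zero_mul, mul_zero,
    Finset.sum_const_zero, add_zero, sub_zero]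

/-- Infinitesimal rotations, displacements and elongations of the parts of the system. -/
abbrev Direction := (Vec × Vec) × (Fin 4 → Vec × ℝ) × (Fin 4 → Vec)

/-- The tangent vector at `x` of the configuration space with given direction. -/
def tangentAt (d : Direction) (x : Ambient) : Ambient :=
  ((loadAtt x * hat d.1.1, d.1.2), fun j => (hat (d.2.1 j).1 *ᵥ cableDir x j, (d.2.1 j).2),
    fun j => quadAtt x j * hat (d.2.2 j))

/-- Writing `δq_j = ω × q_j` builds the sphere constraint into the direction, so all components of
`d` are free. Then `F ⬝ (ω × q) = ω ⬝ (q × F)` isolates the transverse force. -/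
theorem balance_tangentAt (hγ : γ t ∈ Q) (d : Direction) :
    balance P T f M γ t (tangentAt d (γ t)) =
      loadForceResidual P T f γ t ⬝ᵥ d.1.2 + loadMomentResidual P T f γ t ⬝ᵥ d.1.1
      + ∑ j, quadMomentResidual P T M γ j t ⬝ᵥ d.2.2 j
      + ∑ j, cableResidual P T f γ j t * (d.2.1 j).2
      - ∑ j, cableLen (γ t) j *
          ((d.2.1 j).1 ⬝ᵥ (cableDir (γ t) j ⨯₃ quadForce P T f γ j t)) := by
  have hR := transpose_mul_self_of_mem hγ.1
  have e1 : loadAtt (tangentAt d (γ t)) = loadAtt (γ t) * hat d.1.1 := rfl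
  have e2 : ∀ j, quadAtt (tangentAt d (γ t)) j = quadAtt (γ t) j * hat (d.2.2 j) := fun _ => rfl
  have e3 : ∀ j, cableDir (tangentAt d (γ t)) j = (d.2.1 j).1 ⨯₃ cableDir (γ t) j := fun j =>
    hat_mulVec _ _
  have e4 : ∀ j, cableLen (tangentAt d (γ t)) j = (d.2.1 j).2 := fun _ => rfl
  have e5 : loadPos (tangentAt d (γ t)) = d.1.2 := rfl
  rw [balance_eq hR (e1 ▸ isOrthTangent_mul_hat hR _)]
  simp only [e1, e2, e3, e4, e5, bodyVel_mul_hat hR,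
    bodyVel_mul_hat (transpose_mul_self_of_mem (hγ.2.2 _)), triple_product_permutation (quadForce _ _ _ _ _ _)]

theorem balanced_of_balance_eq_zero (hγ : γ t ∈ Q) (hl : ∀ j, cableLen (γ t) j ≠ 0)
    (h : ∀ d, balance P T f M γ t (tangentAt d (γ t)) = 0) : Balanced P T f M γ t := by
  -- The test direction is made of the residuals themselves. The entry `-l_j (q_j × F_j)` cancels
  -- the sign and supplies a second factor `l_j`, so that all terms are nonnegative.
  have key := h ((loadMomentResidual P T f γ t, loadForceResidual P T f γ t),
    fun j => (-(cableLen (γ t) j • (cableDir (γ t) j ⨯₃ quadForce P T f γ j t)),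
      cableResidual P T f γ j t), fun j => quadMomentResidual P T M γ j t)
  rw [balance_tangentAt hγ] at key
  simp only [neg_dotProduct, smul_dotProduct, smul_eq_mul, mul_neg, Finset.sum_neg_distrib,
    sub_neg_eq_add, ← mul_assoc] at key
  have sq : ∀ v : Vec, 0 ≤ v ⬝ᵥ v := fun v => Finset.sum_nonneg fun i _ => mul_self_nonneg (v i)
  have n1 := sq (loadForceResidual P T f γ t)
  have n2 := sq (loadMomentResidual P T f γ t)
  have p3 := fun j (_ : j ∈ Finset.univ) => sq (quadMomentResidual P T M γ j t)
  have p4 := fun j (_ : j ∈ Finset.univ) => mul_self_nonneg (cableResidual P T f γ j t)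
  have p5 := fun j (_ : j ∈ Finset.univ) => mul_nonneg (mul_self_nonneg (cableLen (γ t) j))
    (sq (cableDir (γ t) j ⨯₃ quadForce P T f γ j t))
  have n3 := Finset.sum_nonneg p3
  have n4 := Finset.sum_nonneg p4
  have n5 := Finset.sum_nonneg p5
  refine ⟨dotProduct_self_eq_zero.1 (by linarith), dotProduct_self_eq_zero.1 (by linarith),
    fun j => dotProduct_self_eq_zero.1 ((Finset.sum_eq_zero_iff_of_nonneg p3).1 (by linarith) j
      (Finset.mem_univ j)),
    fun j => mul_self_eq_zero.1 ((Finset.sum_eq_zero_iff_of_nonneg p4).1 (by linarith) j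
      (Finset.mem_univ j)), fun j => dotProduct_self_eq_zero.1 ?_⟩
  exact (mul_eq_zero.1 ((Finset.sum_eq_zero_iff_of_nonneg p5).1 (by linarith) j
    (Finset.mem_univ j))).resolve_left (mul_self_ne_zero.2 (hl j))

theorem hasDerivWithinAt_zeta (hγ : ContDiffOn ℝ ∞ γ (Icc 0 T)) (ht : t ∈ Icc 0 T) (j : Fin 4) :
    HasDerivWithinAt (zeta γ j) (cableLen (γ t) j • cableDir (ddt T γ t) j
      + cableLen (ddt T γ t) j • cableDir (γ t) j) (Icc 0 T) t :=
  ((hγ.hasDerivWithinAt_ddt ht).cableLen j).smul ((hγ.hasDerivWithinAt_ddt ht).cableDir j)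

theorem loadAtt_ddt (hT : 0 < T) (hγ : IsCurve T a b γ) (ht : t ∈ Icc 0 T) :
    loadAtt (ddt T γ t) = loadAtt (γ t) * hat (loadAngVel T γ t) :=
  have hR : ∀ τ ∈ Icc 0 T, (loadAtt (γ τ))ᵀ * loadAtt (γ τ) = 1 := fun τ hτ =>
    transpose_mul_self_of_mem (hγ.mem τ hτ).1
  ((isOrthTangent_of_hasDerivWithinAt (hγ.smooth.hasDerivWithinAt_ddt ht).loadAtt
    (uniqueDiffOn_Icc hT t ht) ht hR).mul_hat (hR t ht)).symm

theorem quadAtt_ddt (hT : 0 < T) (hγ : IsCurve T a b γ) (ht : t ∈ Icc 0 T) (j : Fin 4) :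
    quadAtt (ddt T γ t) j = quadAtt (γ t) j * hat (quadAngVel T γ j t) :=
  have hR : ∀ τ ∈ Icc 0 T, (quadAtt (γ τ) j)ᵀ * quadAtt (γ τ) j = 1 := fun τ hτ =>
    transpose_mul_self_of_mem ((hγ.mem τ hτ).2.2 j)
  ((isOrthTangent_of_hasDerivWithinAt ((hγ.smooth.hasDerivWithinAt_ddt ht).quadAtt j)
    (uniqueDiffOn_Icc hT t ht) ht hR).mul_hat (hR t ht)).symm

/-- Differentiate `x_L + R_L r_j - ζ_j` twice; the middle term gives `R_L(Ω̂_L² + Ω̂_L')r_j` through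
`R_L' = R_L Ω̂_L`. -/
theorem ddt_quadVel (hT : 0 < T) (hγ : IsCurve T a b γ) (ht : t ∈ Icc 0 T) (j : Fin 4) :
    ddt T (quadVel P T γ j) t = ddt T (loadVel T γ) t
      + attachAcc P T γ (loadAngVel T γ) j t - ddt T (ddt T (zeta γ j)) t := by
  have hu := uniqueDiffOn_Icc hT
  have h1 := hγ.smooth.hasDerivWithinAt_ddt ht
  have h2 := (contDiffOn_ddt hT hγ.smooth).hasDerivWithinAt_ddt ht
  have hz : ∀ τ ∈ Icc 0 T, ddt T (zeta γ j) τ = cableLen (γ τ) j • cableDir (ddt T γ τ) j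
      + cableLen (ddt T γ τ) j • cableDir (γ τ) j := fun τ hτ =>
    (hasDerivWithinAt_zeta hγ.smooth hτ j).derivWithin (hu τ hτ)
  -- The explicit first derivative of `ζ_j` is used only to know that it is differentiable; the
  -- second derivative remains unexpanded.
  have hz2 : HasDerivWithinAt (ddt T (zeta γ j)) (ddt T (ddt T (zeta γ j)) t) (Icc 0 T) t := by
    have h := (((h1.cableLen j).smul (h2.cableDir j)).add
      ((h2.cableLen j).smul (h1.cableDir j))).congr hz (hz t ht)
    exact h.differentiableWithinAt.hasDerivWithinAt
  have hv := (contDiffOn_loadVel hT hγ.smooth).hasDerivWithinAt_ddt ht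
  have hΩ := (contDiffOn_loadAngVel hT hγ.smooth).hasDerivWithinAt_ddt ht
  have hw := ((hv.add ((h1.loadAtt.mat_mul hΩ.hat).mulVec_const (P.r j))).sub hz2)
  have he : ∀ τ ∈ Icc 0 T, quadVel P T γ j τ = loadVel T γ τ
      + (loadAtt (γ τ) * hat (loadAngVel T γ τ)) *ᵥ P.r j - ddt T (zeta γ j) τ := fun τ hτ => by
    rw [hz τ hτ, ← loadAtt_ddt hT hγ hτ, quadVel, quadPosDiff, loadVel]
    abel
  rw [ddt, (hw.congr he (he t ht)).derivWithin (hu t ht), loadAtt_ddt hT hγ ht, attachAcc,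
    Matrix.mul_add, Matrix.mul_assoc]

end Balance

/-! ### Residuals in the form of the Euler–Lagrange equations -/

section EulerLagrange

variable {P : Params} {T : ℝ} {f : Fin 4 → ℝ → ℝ} {M : Fin 4 → ℝ → Vec} {a b : Ambient}
  {γ : ℝ → Ambient} {t : ℝ}

/-- The bracket is the difference of the two vectors compared in the cable equations: its dot and
cross products with `q_j` give the longitudinal and transverse equations. -/
theorem quadForce_eq (hT : 0 < T) (hγ : IsCurve T a b γ) (ht : t ∈ Icc 0 T) (j : Fin 4) :
    quadForce P T f γ j t = P.mQ • (ddt T (ddt T (zeta γ j)) t - (ddt T (loadVel T γ) t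
      + attachAcc P T γ (loadAngVel T γ) j t + P.g • e3 - (1 / P.mQ) • thrust f γ j t)) := by
  rw [quadForce, ddt_quadVel hT hγ ht]
  ext i
  have := P.mQ_pos.ne'
  simp
  field_simp
  ring

theorem loadForceResidual_eq (hT : 0 < T) (hγ : IsCurve T a b γ) (ht : t ∈ Icc 0 T) :
    loadForceResidual P T f γ t =
      (∑ j, (thrust f γ j t + P.mQ • ddt T (ddt T (zeta γ j)) t
        - P.mQ • attachAcc P T γ (loadAngVel T γ) j t))
      - mEff P • (ddt T (loadVel T γ) t + P.g • e3) := by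
  ext i
  simp [loadForceResidual, quadForce, ddt_quadVel hT hγ ht, mEff, Fin.sum_univ_four]
  ring

theorem JEff_mulVec (P : Params) (v : Vec) :
    JEff P *ᵥ v = P.JL *ᵥ v - ∑ j, P.mQ • (P.r j ⨯₃ (P.r j ⨯₃ v)) := by
  simp only [JEff, Matrix.sub_mulVec, Matrix.sum_mulVec, Matrix.smul_mulVec, ← Matrix.mulVec_mulVec,
    hat_mulVec]

/-- The identity behind `JEff`: seen from the body frame, the acceleration of a mass at `r`
contributes exactly the rigid-body terms of the inertia `-m r̂²`. The quadratic part in `w` is the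
Jacobi identity for `w`, `r` and `r × w`. -/
theorem cross_centrifugal (r w v : Vec) :
    r ⨯₃ (r ⨯₃ v) + w ⨯₃ (r ⨯₃ (r ⨯₃ w)) = -(r ⨯₃ (w ⨯₃ (w ⨯₃ r) + v ⨯₃ r)) := by
  ext i
  fin_cases i <;> simp [cross_apply] <;> ring

theorem loadMomentResidual_eq (hT : 0 < T) (hγ : IsCurve T a b γ) (ht : t ∈ Icc 0 T) :
    loadMomentResidual P T f γ t =
      (∑ j, P.mQ • hat (P.r j) *ᵥ ((loadAtt (γ t))ᵀ *ᵥ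
        (-(P.g • e3) - ddt T (loadVel T γ) t + ddt T (ddt T (zeta γ j)) t
          + (1 / P.mQ) • thrust f γ j t)))
      - (JEff P *ᵥ ddt T (loadAngVel T γ) t
        + hat (loadAngVel T γ t) *ᵥ (JEff P *ᵥ loadAngVel T γ t)) := by
  have hR := transpose_mul_self_of_mem (hγ.mem t ht).1
  have hj : ∀ j, P.r j ⨯₃ ((loadAtt (γ t))ᵀ *ᵥ quadForce P T f γ j t) =
      P.mQ • hat (P.r j) *ᵥ ((loadAtt (γ t))ᵀ *ᵥ
        (-(P.g • e3) - ddt T (loadVel T γ) t + ddt T (ddt T (zeta γ j)) t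
          + (1 / P.mQ) • thrust f γ j t))
      + P.mQ • (P.r j ⨯₃ (P.r j ⨯₃ ddt T (loadAngVel T γ) t))
      + loadAngVel T γ t ⨯₃ (P.mQ • (P.r j ⨯₃ (P.r j ⨯₃ loadAngVel T γ t))) := fun j => by
    have h1 : (loadAtt (γ t))ᵀ *ᵥ attachAcc P T γ (loadAngVel T γ) j t =
        loadAngVel T γ t ⨯₃ (loadAngVel T γ t ⨯₃ P.r j) + ddt T (loadAngVel T γ) t ⨯₃ P.r j := by
      rw [attachAcc, Matrix.mulVec_mulVec, ← Matrix.mul_assoc, hR, Matrix.one_mul,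
        Matrix.add_mulVec, ← Matrix.mulVec_mulVec, hat_mulVec, hat_mulVec, hat_mulVec]
    have h2 : quadForce P T f γ j t = P.mQ • ((-(P.g • e3) - ddt T (loadVel T γ) t
        + ddt T (ddt T (zeta γ j)) t + (1 / P.mQ) • thrust f γ j t)
        - attachAcc P T γ (loadAngVel T γ) j t) := by
      rw [quadForce_eq hT hγ ht]
      congr 1
      abel
    have h3 := neg_eq_iff_eq_neg.2
      (cross_centrifugal (P.r j) (loadAngVel T γ t) (ddt T (loadAngVel T γ) t))
    rw [h2, Matrix.mulVec_smul, Matrix.mulVec_sub, h1, map_smul, map_sub, hat_mulVec, map_smul,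
      ← h3]
    module
  have hΩ : (P.JL *ᵥ loadAngVel T γ t) ⨯₃ loadAngVel T γ t =
      -(loadAngVel T γ t ⨯₃ (P.JL *ᵥ loadAngVel T γ t)) := (cross_anticomm _ _).symm
  rw [loadMomentResidual, hΩ, JEff_mulVec, JEff_mulVec, hat_mulVec, map_sub, map_sum,
    Finset.sum_congr rfl fun j _ => hj j, Finset.sum_add_distrib, Finset.sum_add_distrib]
  abel

theorem eulerLagrange_iff_balanced (hT : 0 < T) (hγ : IsCurve T a b γ) :
    EulerLagrange P T f M γ (loadVel T γ) (loadAngVel T γ) (quadAngVel T γ) ↔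
      ∀ t ∈ Icc 0 T, Balanced P T f M γ t := by
  have hm := P.mQ_pos.ne'
  have hu := uniqueDiffOn_Icc hT
  have hd : ∀ t ∈ Icc 0 T, HasDerivWithinAt γ (ddt T γ t) (Icc 0 T) t := fun t ht =>
    hγ.smooth.hasDerivWithinAt_ddt ht
  have hlen : ∀ j, ∀ t ∈ Icc 0 T,
      ddt T (fun τ => cableLen (γ τ) j) t = cableLen (ddt T γ t) j := fun j t ht =>
    ((hd t ht).cableLen j).derivWithin (hu t ht)
  have hcable : ∀ j, ∀ t ∈ Icc 0 T, cableResidual P T f γ j t =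
      P.mQ * (cableDir (γ t) j ⬝ᵥ (ddt T (loadVel T γ) t
        + attachAcc P T γ (loadAngVel T γ) j t + P.g • e3 - (1 / P.mQ) • thrust f γ j t))
      - P.c * ddt T (fun τ => cableLen (γ τ) j) t + P.k * (P.L - cableLen (γ t) j)
      - P.mQ * (cableDir (γ t) j ⬝ᵥ ddt T (ddt T (zeta γ j)) t) := fun j t ht => by
    rw [cableResidual, quadForce_eq hT hγ ht, hlen j t ht, dotProduct_smul, smul_eq_mul,
      dotProduct_sub]
    ring
  constructor
  · intro h t ht
    refine ⟨?_, ?_, fun j => sub_eq_zero.2 (h.quad_att_dyn j t ht).symm, fun j => ?_, fun j => ?_⟩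
    · rw [loadForceResidual_eq hT hγ ht, h.load_pos_dyn t ht, sub_self]
    · rw [loadMomentResidual_eq hT hγ ht, h.load_att_dyn t ht, sub_self]
    · rw [hcable j t ht, h.cable_len_dyn j t ht, sub_self]
    · rw [quadForce_eq hT hγ ht, map_smul, map_sub, h.cable_dir_dyn j t ht, sub_self, smul_zero]
  · intro h
    refine ⟨fun t ht => (hd t ht).loadPos.derivWithin (hu t ht), fun t ht => ?_, fun t ht => ?_,
      fun t ht => ?_, fun j t ht => ?_, fun j t ht => ?_,
      fun j t ht => (sub_eq_zero.1 ((h t ht).quadMoment j)).symm, fun j t ht => ?_⟩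
    · exact ((hd t ht).loadAtt.derivWithin (hu t ht)).trans (loadAtt_ddt hT hγ ht)
    · exact (sub_eq_zero.1 ((loadForceResidual_eq hT hγ ht).symm.trans (h t ht).loadForce)).symm
    · exact (sub_eq_zero.1 ((loadMomentResidual_eq hT hγ ht).symm.trans (h t ht).loadMoment)).symm
    · exact (sub_eq_zero.1 ((hcable j t ht).symm.trans ((h t ht).cableLength j))).symm
    · have hc := (h t ht).cableDirection j
      rw [quadForce_eq hT hγ ht, map_smul, map_sub] at hc
      exact sub_eq_zero.1 ((smul_eq_zero.1 hc).resolve_left hm)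
    · exact (((hd t ht).quadAtt j).derivWithin (hu t ht)).trans (quadAtt_ddt hT hγ ht j)

/-- The kinematic equations determine the velocities on `[0, T]`, hence also their derivatives
within `[0, T]`. Outside the interval the given functions may be arbitrary. -/
theorem EulerLagrange.canonical (hT : 0 < T) (hγ : IsCurve T a b γ) {vL ΩL : ℝ → Vec}
    {Ω : Fin 4 → ℝ → Vec} (h : EulerLagrange P T f M γ vL ΩL Ω) :
    EulerLagrange P T f M γ (loadVel T γ) (loadAngVel T γ) (quadAngVel T γ) := by
  have hu := uniqueDiffOn_Icc hT
  have hd : ∀ t ∈ Icc 0 T, HasDerivWithinAt γ (ddt T γ t) (Icc 0 T) t := fun t ht =>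
    hγ.smooth.hasDerivWithinAt_ddt ht
  have e1 : ∀ t ∈ Icc 0 T, loadVel T γ t = vL t := fun t ht =>
    ((hd t ht).loadPos.derivWithin (hu t ht)).symm.trans (h.load_pos_kin t ht)
  have e2 : ∀ t ∈ Icc 0 T, loadAngVel T γ t = ΩL t := fun t ht => by
    have h1 := ((hd t ht).loadAtt.derivWithin (hu t ht)).symm.trans (h.load_att_kin t ht)
    rw [loadAngVel, h1, bodyVel_mul_hat (transpose_mul_self_of_mem (hγ.mem t ht).1)]
  have e3 : ∀ j, ∀ t ∈ Icc 0 T, quadAngVel T γ j t = Ω j t := fun j t ht => by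
    have h1 := (((hd t ht).quadAtt j).derivWithin (hu t ht)).symm.trans (h.quad_att_kin j t ht)
    rw [quadAngVel, h1, bodyVel_mul_hat (transpose_mul_self_of_mem ((hγ.mem t ht).2.2 j))]
  have d1 : ∀ t ∈ Icc 0 T, ddt T (loadVel T γ) t = ddt T vL t := fun t ht =>
    derivWithin_congr e1 (e1 t ht)
  have d2 : ∀ t ∈ Icc 0 T, ddt T (loadAngVel T γ) t = ddt T ΩL t := fun t ht =>
    derivWithin_congr e2 (e2 t ht)
  have d3 : ∀ j, ∀ t ∈ Icc 0 T, ddt T (quadAngVel T γ j) t = ddt T (Ω j) t := fun j t ht =>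
    derivWithin_congr (e3 j) (e3 j t ht)
  have e4 : ∀ j, ∀ t ∈ Icc 0 T,
      attachAcc P T γ (loadAngVel T γ) j t = attachAcc P T γ ΩL j t := fun j t ht => by
    rw [attachAcc, attachAcc, e2 t ht, d2 t ht]
  refine ⟨fun t ht => ?_, fun t ht => ?_, fun t ht => ?_, fun t ht => ?_, fun j t ht => ?_,
    fun j t ht => ?_, fun j t ht => ?_, fun j t ht => ?_⟩
  · rw [e1 t ht, h.load_pos_kin t ht]
  · rw [e2 t ht, h.load_att_kin t ht]
  · simp only [d1 t ht, e4 _ t ht, h.load_pos_dyn t ht]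
  · simp only [d1 t ht, d2 t ht, e2 t ht, h.load_att_dyn t ht]
  · rw [d1 t ht, e4 j t ht, h.cable_len_dyn j t ht]
  · rw [d1 t ht, e4 j t ht, h.cable_dir_dyn j t ht]
  · rw [d3 j t ht, e3 j t ht, h.quad_att_dyn j t ht]
  · rw [e3 j t ht, h.quad_att_kin j t ht]

end EulerLagrange

/-! ### Test variations -/

section TestVariation

/-- The rotation obtained from `w` by the Cayley transform of `hat w / 2`. -/
def cayley (w : Vec) : Mat :=
  (4 + w ⬝ᵥ w)⁻¹ • ((4 - w ⬝ᵥ w) • (1 : Mat) + (4 : ℝ) • hat w + (2 : ℝ) • Matrix.vecMulVec w w)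

theorem four_add_dot_self_pos (w : Vec) : 0 < 4 + w ⬝ᵥ w :=
  add_pos_of_pos_of_nonneg four_pos (Finset.sum_nonneg fun i _ => mul_self_nonneg (w i))

theorem cayley_zero : cayley 0 = 1 := by
  have h : hat 0 = 0 := by
    ext i k
    fin_cases i <;> fin_cases k <;> simp [hat]
  simp [cayley, h]

/-- After clearing the positive denominator, both conditions are polynomial identities: the
numerator `N` satisfies `NᵀN = (4 + |w|²)² • 1` and `det N = (4 + |w|²)³`. -/
theorem cayley_mem (w : Vec) : cayley w ∈ Matrix.specialOrthogonalGroup (Fin 3) ℝ := by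
  have hpos := four_add_dot_self_pos w
  have hne : 4 + w ⬝ᵥ w ≠ 0 := hpos.ne'
  rw [Matrix.mem_specialOrthogonalGroup_iff, Matrix.mem_orthogonalGroup_iff']
  have h1 : ∀ N : Mat, Nᵀ * N = (4 + w ⬝ᵥ w) ^ 2 • (1 : Mat) →
      ((4 + w ⬝ᵥ w)⁻¹ • N)ᵀ * ((4 + w ⬝ᵥ w)⁻¹ • N) = 1 := fun N hN => by
    rw [Matrix.transpose_smul, Matrix.smul_mul, Matrix.mul_smul, hN, smul_smul, smul_smul,
      show (4 + w ⬝ᵥ w)⁻¹ * (4 + w ⬝ᵥ w)⁻¹ * (4 + w ⬝ᵥ w) ^ 2 = 1 by field_simp, one_smul]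
  have h2 : ∀ N : Mat, N.det = (4 + w ⬝ᵥ w) ^ 3 → ((4 + w ⬝ᵥ w)⁻¹ • N).det = 1 := fun N hN => by
    rw [Matrix.det_smul, hN, Fintype.card_fin, ← mul_pow, inv_mul_cancel₀ hne, one_pow]
  refine ⟨h1 _ ?_, h2 _ ?_⟩
  · ext i k
    fin_cases i <;> fin_cases k <;>
    simp [Matrix.mul_apply, hat, Matrix.vecMulVec_apply, dotProduct, Fin.sum_univ_three] <;> ring
  · simp [Matrix.det_fin_three, hat, Matrix.vecMulVec_apply, dotProduct, Fin.sum_univ_three]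
    ring

theorem contDiff_cayley : ContDiff ℝ ∞ cayley := by
  refine contDiff_pi.2 fun i => contDiff_pi.2 fun k => ?_
  have h1 : ContDiff ℝ ∞ fun w : Vec => w ⬝ᵥ w := by
    simp only [dotProduct]
    fun_prop
  have h2 : ContDiff ℝ ∞ fun w : Vec => (4 + w ⬝ᵥ w)⁻¹ :=
    (contDiff_const.add h1).inv fun w => (four_add_dot_self_pos w).ne'
  have h3 : ContDiff ℝ ∞ fun w : Vec => hat w i k := by
    fin_cases i <;> fin_cases k <;> simp [hat] <;> fun_prop
  simp only [cayley, Matrix.smul_apply, Matrix.add_apply, Matrix.vecMulVec_apply, smul_eq_mul]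
  fun_prop

theorem hat_smul (c : ℝ) (w : Vec) : hat (c • w) = c • hat w := by
  ext i k
  fin_cases i <;> fin_cases k <;> simp [hat]

theorem hasDerivAt_cayley (w : Vec) :
    HasDerivAt (fun s : ℝ => cayley (s • w)) (hat w) 0 := by
  -- On the line `s • w` each entry is a quotient of quadratic polynomials in `s`. The denominator
  -- has no linear term, so only the linear term `4 s ŵ` of the numerator, divided by `4`, survives
  -- at `0`.
  have h1 : ∀ A B C : ℝ, HasDerivAt (fun s : ℝ => A + s * B + s * s * C) B 0 := fun A B C => by
    have hid := hasDerivAt_id (0 : ℝ)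
    have h := ((hid.mul_const B).const_add A).add ((hid.mul hid).mul_const C)
    exact h.congr_deriv (by simp)
  have h2 : HasDerivAt (fun s : ℝ => (4 + s * 0 + s * s * (w ⬝ᵥ w))⁻¹) 0 0 := by
    simpa using (h1 4 0 (w ⬝ᵥ w)).fun_inv (by simp)
  refine hasDerivWithinAt_univ.1 (hasDerivWithinAt_mat.2 fun i k => hasDerivWithinAt_univ.2 ?_)
  have h3 := h2.mul (h1 (4 * (1 : Mat) i k) (4 * hat w i k) (2 * (w i * w k) - w ⬝ᵥ w * (1 : Mat) i k))
  refine (h3.congr_deriv (by ring)).congr_of_eventuallyEq (Filter.Eventually.of_forall fun s => ?_)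
  simp only [cayley, hat_smul, Matrix.smul_apply, Matrix.add_apply, Matrix.vecMulVec_apply,
    smul_dotProduct, dotProduct_smul, smul_eq_mul, Pi.smul_apply, Pi.mul_apply, mul_zero, add_zero,
    ← mul_assoc]
  ring

/-- The configuration reached from `x` after the time `θ` in the direction `d`. -/
def vary (d : Direction) (θ : ℝ) (x : Ambient) : Ambient :=
  ((loadAtt x * cayley (θ • d.1.1), loadPos x + θ • d.1.2),
    fun j => (cayley (θ • (d.2.1 j).1) *ᵥ cableDir x j, cableLen x j + θ * (d.2.1 j).2),
    fun j => quadAtt x j * cayley (θ • d.2.2 j))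

theorem vary_zero (d : Direction) (x : Ambient) : vary d 0 x = x := by
  simp only [vary, zero_smul, cayley_zero, Matrix.mul_one, Matrix.one_mulVec, add_zero, zero_mul]
  rfl

theorem vary_mem (d : Direction) (θ : ℝ) {x : Ambient} (hx : x ∈ Q) : vary d θ x ∈ Q := by
  refine ⟨mul_mem hx.1 (cayley_mem _), fun j => ?_, fun j => mul_mem (hx.2.2 j) (cayley_mem _)⟩
  change (cayley _ *ᵥ cableDir x j) ⬝ᵥ (cayley _ *ᵥ cableDir x j) = 1
  rw [Matrix.dotProduct_mulVec, ← Matrix.mulVec_transpose, Matrix.mulVec_mulVec,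
    transpose_mul_self_of_mem (cayley_mem _), Matrix.one_mulVec, hx.2.1 j]

theorem contDiff_vary (d : Direction) :
    ContDiff ℝ ∞ (fun p : ℝ × Ambient => vary d p.1 p.2) := by
  have hc : ∀ (w : Vec) (i k : Fin 3),
      ContDiff ℝ ∞ fun p : ℝ × Ambient => cayley (p.1 • w) i k := fun w i k => by
    have h : ContDiff ℝ ∞ fun p : ℝ × Ambient => cayley (p.1 • w) :=
      contDiff_cayley.comp (contDiff_fst.smul contDiff_const)
    exact contDiff_pi.1 (contDiff_pi.1 h i) k
  refine ContDiff.prodMk (ContDiff.prodMk (contDiff_pi.2 fun i => contDiff_pi.2 fun k => ?_) ?_)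
    (ContDiff.prodMk (contDiff_pi.2 fun j => ContDiff.prodMk (contDiff_pi.2 fun i => ?_) ?_)
      (contDiff_pi.2 fun j => contDiff_pi.2 fun i => contDiff_pi.2 fun k => ?_))
  · simp only [Matrix.mul_apply, loadAtt]
    fun_prop
  · simp only [loadPos]
    fun_prop
  · simp only [Matrix.mulVec, dotProduct, cableDir]
    fun_prop
  · simp only [cableLen]
    fun_prop
  · simp only [Matrix.mul_apply, quadAtt]
    fun_prop

theorem hasDerivAt_vary (d : Direction) (x : Ambient) :
    HasDerivAt (fun θ => vary d θ x) (tangentAt d x) 0 := by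
  have hc := fun w => (hasDerivAt_cayley w).hasDerivWithinAt (s := univ)
  have hm : ∀ (R : Mat) (w : Vec),
      HasDerivAt (fun θ : ℝ => R * cayley (θ • w)) (R * hat w) 0 := fun R w => by
    have h := hasDerivWithinAt_univ.1 ((hasDerivWithinAt_const 0 univ R).mat_mul (hc w))
    exact h.congr_deriv (by rw [Matrix.zero_mul, zero_add])
  refine HasDerivAt.prodMk (HasDerivAt.prodMk (hm _ _) ?_)
    (HasDerivAt.prodMk (hasDerivAt_pi.2 fun j => HasDerivAt.prodMk ?_ ?_)
      (hasDerivAt_pi.2 fun j => hm _ _))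
  · simpa using ((hasDerivAt_id (0 : ℝ)).smul_const d.1.2).const_add (loadPos x)
  · exact hasDerivWithinAt_univ.1 ((hc _).mulVec_const _)
  · simpa using ((hasDerivAt_id (0 : ℝ)).mul_const (d.2.1 j).2).const_add (cableLen x j)

theorem contDiff_tangentAt (d : Direction) : ContDiff ℝ ∞ (tangentAt d) := by
  refine ContDiff.prodMk (ContDiff.prodMk (contDiff_pi.2 fun i => contDiff_pi.2 fun k => ?_) ?_)
    (ContDiff.prodMk (contDiff_pi.2 fun j => ContDiff.prodMk (contDiff_pi.2 fun i => ?_) ?_)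
      (contDiff_pi.2 fun j => contDiff_pi.2 fun i => contDiff_pi.2 fun k => ?_))
  · simp only [Matrix.mul_apply, loadAtt]
    fun_prop
  · exact contDiff_const
  · simp only [Matrix.mulVec, dotProduct, cableDir]
    fun_prop
  · exact contDiff_const
  · simp only [Matrix.mul_apply, quadAtt]
    fun_prop

/-- A fixed direction `d` is switched on in time by `φ`, whose zeros at `0` and `T` fix the
endpoints. The infinitesimal variation is `φ t • tangentAt d (γ t)`, by `deriv_vary`. -/
theorem isVariation_vary {T : ℝ} {a b : Ambient} {γ : ℝ → Ambient}
    (hγ : IsCurve T a b γ) (d : Direction) {φ : ℝ → ℝ} (hφ : ContDiff ℝ ∞ φ)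
    (h0 : φ 0 = 0) (h1 : φ T = 0) :
    IsVariation T a b γ 1 (fun s t => vary d (s * φ t) (γ t)) where
  pos := one_pos
  smooth := by
    have h : ContDiffOn ℝ ∞ (fun p : ℝ × ℝ => γ p.2) (Ioo (-1) 1 ×ˢ Icc 0 T) :=
      hγ.smooth.comp contDiffOn_snd fun p hp => hp.2
    have h' : ContDiff ℝ ∞ fun p : ℝ × ℝ => p.1 * φ p.2 := by fun_prop
    exact (contDiff_vary d).comp_contDiffOn (h'.contDiffOn.prodMk h)
  curve s _ := by
    have h' : ContDiff ℝ ∞ fun t : ℝ => s * φ t := by fun_prop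
    exact ⟨(contDiff_vary d).comp_contDiffOn (h'.contDiffOn.prodMk hγ.smooth),
      fun t ht => vary_mem d _ (hγ.mem t ht), by simp [h0, vary_zero, hγ.left],
      by simp [h1, vary_zero, hγ.right]⟩
  zero t _ := by simp [vary_zero]

theorem deriv_vary (d : Direction) (c : ℝ) (x : Ambient) :
    deriv (fun s => vary d (s * c) x) 0 = c • tangentAt d x := by
  have h1 : HasDerivAt (fun s : ℝ => s * c) c 0 := by
    simpa using (hasDerivAt_id (0 : ℝ)).mul_const c
  have h2 : HasDerivAt (fun θ => vary d θ x) (tangentAt d x) (0 * c) := by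
    rw [zero_mul]
    exact hasDerivAt_vary d x
  exact (h2.scomp 0 h1).deriv

end TestVariation

/-- The fundamental lemma of the calculus of variations. -/
theorem eq_zero_of_forall_integral_mul_eq_zero {T : ℝ} (hT : 0 < T) {h : ℝ → ℝ}
    (hh : ContinuousOn h (Icc 0 T))
    (H : ∀ φ : ℝ → ℝ, ContDiff ℝ ∞ φ → φ 0 = 0 → φ T = 0 → ∫ t in (0 : ℝ)..T, φ t * h t = 0) :
    ∀ t ∈ Icc 0 T, h t = 0 := by
  -- Test functions with compact support in the open interval vanish at `0` and `T`, so they are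
  -- admissible. Continuity then extends the conclusion from almost every point to all of `[0, T]`.
  have hae : ∀ᵐ t, t ∈ Ioo 0 T → h t = 0 := by
    refine isOpen_Ioo.ae_eq_zero_of_integral_contDiff_smul_eq_zero
      ((hh.mono Ioo_subset_Icc_self).locallyIntegrableOn measurableSet_Ioo) fun φ hφ _ hsupp => ?_
    have hz : ∀ t, t ∉ Ioo 0 T → φ t = 0 := fun t ht =>
      image_eq_zero_of_notMem_tsupport fun h => ht (hsupp h)
    have := H φ hφ (hz 0 fun h => lt_irrefl _ h.1) (hz T fun h => lt_irrefl _ h.2)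
    rw [intervalIntegral.integral_of_le hT.le, setIntegral_eq_integral_of_forall_compl_eq_zero] at this
    · exact this
    · exact fun t ht => by rw [hz t fun h => ht (Ioo_subset_Ioc_self h), zero_mul]
  have hres : h =ᵐ[volume.restrict (Icc 0 T)] fun _ => 0 := by
    rw [← Measure.restrict_congr_set (Ioo_ae_eq_Icc (μ := volume))]
    exact (ae_restrict_iff' measurableSet_Ioo).2 hae
  exact fun t ht => Measure.eqOn_Icc_of_ae_eq volume hT.ne hres hh continuousOn_const ht

/-! ### The two implications between criticality and balance -/

theorem balance_smul (P : Params) (T : ℝ) (f : Fin 4 → ℝ → ℝ) (M : Fin 4 → ℝ → Vec)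
    (γ : ℝ → Ambient) (t c : ℝ) (v : Ambient) :
    balance P T f M γ t (c • v) = c * balance P T f M γ t v := by
  have e1 : loadAtt (c • v) = c • loadAtt v := rfl
  have e2 : loadPos (c • v) = c • loadPos v := rfl
  have e3 : ∀ j, cableLen (c • v) j = c * cableLen v j := fun _ => rfl
  have e4 : ∀ j, quadAtt (c • v) j = c • quadAtt v j := fun _ => rfl
  have e5 : ∀ j, quadPosDiff P (γ t) (c • v) j = c • quadPosDiff P (γ t) v j := fun j => by
    have e6 : cableDir (c • v) j = c • cableDir v j := rfl
    simp only [quadPosDiff, e1, e2, e3, e6, Matrix.smul_mulVec]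
    module
  have hb : ∀ R X : Mat, bodyVel R (c • X) = c • bodyVel R X := fun R X => by
    ext i
    fin_cases i <;> simp [bodyVel, vee]
  simp only [balance, e1, e2, e3, e4, e5, hb, smul_dotProduct, dotProduct_smul, smul_eq_mul,
    mul_left_comm _ c, ← Finset.mul_sum]
  ring

/-- For each fixed `d`, linearity takes `φ` out of `balance`, and the fundamental lemma applies to
the remaining continuous function of time. -/
theorem IsCritical.balanced {P : Params} {T : ℝ} {f : Fin 4 → ℝ → ℝ} {M : Fin 4 → ℝ → Vec}
    {a b : Ambient} {γ : ℝ → Ambient} (hT : 0 < T) (hf : ∀ j, ContinuousOn (f j) (Icc 0 T))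
    (hM : ∀ j, ContinuousOn (M j) (Icc 0 T)) (hγ : IsCurve T a b γ)
    (hl : ∀ j, ∀ t ∈ Icc 0 T, cableLen (γ t) j ≠ 0) (h : IsCritical P T f M a b γ) :
    ∀ t ∈ Icc 0 T, Balanced P T f M γ t := by
  rw [isCritical_iff_integral_balance hT hf hM hγ] at h
  refine fun t ht => balanced_of_balance_eq_zero (hγ.mem t ht) (fun j => hl j t ht) fun d => ?_
  have hb : ContinuousOn (fun t => balance P T f M γ t (tangentAt d (γ t))) (Icc 0 T) :=
    continuousOn_balance hT hf hM hγ.smooth ((contDiff_tangentAt d).comp_contDiffOn hγ.smooth).continuousOn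
  refine eq_zero_of_forall_integral_mul_eq_zero hT hb (fun φ hφ h0 h1 => ?_) t ht
  have hφ' := h 1 _ (isVariation_vary hγ d hφ h0 h1)
  simpa only [deriv_vary, balance_smul] using hφ'

/-- The integrand vanishes at each time: every curve `s ↦ Γ s t` lies in `Q`, so its velocity at `0`
satisfies the tangency conditions of `Balanced.balance_eq_zero`. -/
theorem Balanced.isCritical {P : Params} {T : ℝ} {f : Fin 4 → ℝ → ℝ} {M : Fin 4 → ℝ → Vec}
    {a b : Ambient} {γ : ℝ → Ambient} (hT : 0 < T) (hf : ∀ j, ContinuousOn (f j) (Icc 0 T))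
    (hM : ∀ j, ContinuousOn (M j) (Icc 0 T)) (hγ : IsCurve T a b γ)
    (h : ∀ t ∈ Icc 0 T, Balanced P T f M γ t) : IsCritical P T f M a b γ := by
  rw [isCritical_iff_integral_balance hT hf hM hγ]
  intro ε Γ hΓ
  have h0 : (0 : ℝ) ∈ Ioo (-ε) ε := ⟨by linarith [hΓ.pos], hΓ.pos⟩
  have hu := isOpen_Ioo.uniqueDiffOn (𝕜 := ℝ) 0 h0
  rw [intervalIntegral.integral_congr (g := fun _ => 0), intervalIntegral.integral_zero]
  intro t ht
  rw [uIcc_of_le hT.le] at ht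
  have hs : HasDerivWithinAt (fun s => Γ s t) (deriv (fun s => Γ s t) 0) (Ioo (-ε) ε) 0 :=
    (hasDerivAt_partialS (G := fun p : ℝ × ℝ => Γ p.1 p.2) hΓ.smooth (p := (0, t))
      ⟨h0, ht⟩).differentiableAt.hasDerivAt.hasDerivWithinAt
  have hmem := fun s hs => (hΓ.curve s hs).mem t ht
  have hR := isOrthTangent_of_hasDerivWithinAt hs.loadAtt hu h0 fun s hs =>
    transpose_mul_self_of_mem (hmem s hs).1
  have hq : ∀ j, cableDir (γ t) j ⬝ᵥ cableDir (deriv (fun s => Γ s t) 0) j = 0 := fun j => by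
    have h1 := (hs.cableDir j).dot (hs.cableDir j)
    have h2 : HasDerivWithinAt (fun s => cableDir (Γ s t) j ⬝ᵥ cableDir (Γ s t) j) 0
        (Ioo (-ε) ε) 0 :=
      (hasDerivWithinAt_const 0 _ (1 : ℝ)).congr (fun s hs => (hmem s hs).2.1 j) ((hmem 0 h0).2.1 j)
    have h3 := hu.eq_deriv _ h1 h2
    simp only [hΓ.zero t ht] at h3
    have h4 := dotProduct_comm (cableDir (γ t) j) (cableDir (deriv (fun s => Γ s t) 0) j)
    linarith
  simp only [hΓ.zero t ht] at hR
  exact (h t ht).balance_eq_zero (hγ.mem t ht) hR hq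

end QuadLoad

end

theorem proposition1 (P : QuadLoad.Params) (T : ℝ) (hT : 0 < T)
    (f : Fin 4 → ℝ → ℝ) (M : Fin 4 → ℝ → QuadLoad.Vec)
    (hf : ∀ j, ContinuousOn (f j) (Set.Icc 0 T)) (hM : ∀ j, ContinuousOn (M j) (Set.Icc 0 T))
    (a b : QuadLoad.Ambient) (γ : ℝ → QuadLoad.Ambient) (hγ : QuadLoad.IsCurve T a b γ) :
    ((∃ (vL ΩL : ℝ → QuadLoad.Vec) (Ω : Fin 4 → ℝ → QuadLoad.Vec),
        QuadLoad.EulerLagrange P T f M γ vL ΩL Ω) →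
      QuadLoad.IsCritical P T f M a b γ) ∧
    ((∀ j, ∀ t ∈ Set.Icc 0 T, QuadLoad.cableLen (γ t) j ≠ 0) →
      (QuadLoad.IsCritical P T f M a b γ ↔
        ∃ (vL ΩL : ℝ → QuadLoad.Vec) (Ω : Fin 4 → ℝ → QuadLoad.Vec),
          QuadLoad.EulerLagrange P T f M γ vL ΩL Ω)) := by
  have hback : (∃ (vL ΩL : ℝ → QuadLoad.Vec) (Ω : Fin 4 → ℝ → QuadLoad.Vec),
      QuadLoad.EulerLagrange P T f M γ vL ΩL Ω) → QuadLoad.IsCritical P T f M a b γ := by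
    rintro ⟨vL, ΩL, Ω, h⟩
    exact QuadLoad.Balanced.isCritical hT hf hM hγ
      ((QuadLoad.eulerLagrange_iff_balanced hT hγ).1 (h.canonical hT hγ))
  exact ⟨hback, fun hl => ⟨fun h => ⟨_, _, _, (QuadLoad.eulerLagrange_iff_balanced hT hγ).2
    (h.balanced hT hf hM hγ hl)⟩, hback⟩⟩
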